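/- Let $X$ be an Archimedean real vector lattice. A net $(x_\alpha)$ in $X$ ru-converges to $x$ if there is a regulator $u\in X$ such that for every $\varepsilon>0$ one has $|x_\alpha-x|\le\varepsilon u$ for all $\alpha\ge\alpha_\varepsilon$; ru-Cauchy sequences are defined accordingly, and $X$ is ru-complete if every ru-Cauchy sequence ru-converges in $X$. A set $D$ is ru-dense if every element is the ru-limit of a sequence in $D$. $X$ has property $(D)$ if for every net $(T_\alpha)$ of linear operators on $X$ the following two conditions imply that $T_\alpha x$ ru-converges to $0$ for every $x\in X$: (a) there is an ru-dense $D\subset X$ such that $T_\alpha y$ ru-converges to $0$ for every $y\in D$; (b) for every sequence $(x_n)$ that ru-converges to $0$ there is $u\ge0$ such that for every $\varepsilon>0$ there are $N_\varepsilon$ and $\alpha_\varepsilon$ with $|T_\alpha x_n|\le\varepsilon u$ for all $n\ge N_\varepsilon$, $\alpha\ge\alpha_\varepsilon$. Assume that $X$ is ru-complete and has property $(D)$. Let $X_{\mathbb C}=X+iX$ be its complexification with modulus $|x+iy|=\sup_{\theta}|\cos\theta\,x+\sin\theta\,y|$; ru-convergence and ru-density in $X_{\mathbb C}$ are defined as above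 with this modulus and regulators in $X$. An operator on $X_{\mathbb C}$ is positive if it maps $X_+$ into $X_+$. A positive ru-continuous semigroup is a family $(T(t))_{t\ge0}$ of positive linear operators on $X_{\mathbb C}$ with $T(0)=I$, $T(s+t)=T(t)T(s)$, such that for every $x$ there is $u:\mathbb R_+\to X$ such that for every $\varepsilon>0$ there is $\delta>0$ with $|T(t+h)x-T(t)x|\le\varepsilon u(t)$ for all $t\ge0$ and $h\in[-\min\{\delta,t\},\delta]$. It is exponentially order bounded with order exponent $w$ if for every $x$ there is $u\in X$ with $|T(t)x|\le e^{wt}u$ for all $t\ge0$. Its generator is the operator $x\mapsto \mathrm{ru}\text{-}\lim_{h\searrow0}\frac1h(T(h)x-x)$, defined for those $x$ for which this ru-limit exists. Let $w\in\mathbb R$ and let $A:D(A)\subset X_{\mathbb C}\to X_{\mathbb C}$ be a linear operator. Then the following are equivalent. (i) $A$ is the generator of an exponentially order bounded, ru-continuous, positive semigroup on $X_{\mathbb C}$ with order exponent $w$. (ii) $A$ is ru-closed (if $x_n\in D(A)$, $x_n$ ru-converges to $x$ and $Ax_n$ ru-converges to $y$, then $x\in D(A)$ and $Ax=y$) and ru-densely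 defined; for every $\lambda\in\mathbb C$ with $\operatorname{Re}\lambda>w$ the operator $\lambda-A:D(A)\to X_{\mathbb C}$ is bijective, and its inverse $R(\lambda,A)$ is a positive operator whenever $\lambda$ is moreover real; and for each $x\in X_{\mathbb C}$ there is $u\in X$ such that $$|R(\lambda,A)^k x|\le(\operatorname{Re}\lambda-w)^{-k}u$$ for all $k\in\mathbb N$ and all $\lambda\in\mathbb C$ with $\operatorname{Re}\lambda>w$. -/

import Mathlib

open Filter Topology
open scoped NNReal

namespace RuSemigroup

universe u

section Real

variable {X : Type u} [AddCommGroup X] [Lattice X] [Module ℝ X]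

/-- A vector lattice is Archimedean if `0 ≤ n x ≤ y` for all `n` forces `x = 0`. -/
def IsArchimedean (X : Type u) [AddCommGroup X] [Lattice X] : Prop :=
  ∀ x y : X, (∀ n : ℕ, 0 ≤ n • x ∧ n • x ≤ y) → x = 0

/-- Relative uniform convergence of `f` to `x` along a filter, in a real vector lattice.
For a net, the filter is `atTop` on its directed index set. -/
def RuTendsto {ι : Type*} (f : ι → X) (l : Filter ι) (x : X) : Prop :=
  ∃ u : X, ∀ ε : ℝ, 0 < ε → ∀ᶠ i in l, |f i - x| ≤ ε • u

/-- Relatively uniform Cauchy sequences. -/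
def IsRuCauchy (x : ℕ → X) : Prop :=
  ∃ u : X, ∀ ε : ℝ, 0 < ε → ∃ N : ℕ, ∀ n ≥ N, ∀ m ≥ N, |x n - x m| ≤ ε • u

/-- Relative uniform completeness of a real vector lattice. -/
def IsRuComplete (X : Type u) [AddCommGroup X] [Lattice X] [Module ℝ X] : Prop :=
  ∀ x : ℕ → X, IsRuCauchy x → ∃ y : X, RuTendsto x atTop y

/-- A set is ru-dense if every element is the ru-limit of a sequence in the set. -/
def IsRuDense (D : Set X) : Prop :=
  ∀ x : X, ∃ s : ℕ → X, (∀ n, s n ∈ D) ∧ RuTendsto s atTop x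

/-- Property `(D)`. Nets of linear operators are indexed by nonempty directed preordered types.
Since the conditions only see the filter of tails on the set of operators, letting the index
types range over the universe of `X` covers all nets. -/
def PropertyD (X : Type u) [AddCommGroup X] [Lattice X] [Module ℝ X] : Prop :=
  ∀ (ι : Type u) [Preorder ι] [IsDirectedOrder ι] [Nonempty ι] (T : ι → X →ₗ[ℝ] X),
    (∃ D : Set X, IsRuDense D ∧ ∀ y ∈ D, RuTendsto (fun a => T a y) atTop 0) →
    (∀ x : ℕ → X, RuTendsto x atTop 0 →
      ∃ u : X, 0 ≤ u ∧ ∀ ε : ℝ, 0 < ε →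
        ∃ (N : ℕ) (a₀ : ι), ∀ n ≥ N, ∀ a ≥ a₀, |T a (x n)| ≤ ε • u) →
    ∀ x : X, RuTendsto (fun a => T a x) atTop 0

end Real

/-- The complexification `X + iX` of a real vector space `X`. -/
@[ext]
structure Complexification (X : Type u) where
  re : X
  im : X

namespace Complexification

section Algebra

variable {X : Type u} [AddCommGroup X]

instance : Zero (Complexification X) := ⟨⟨0, 0⟩⟩
instance : Add (Complexification X) := ⟨fun z z' => ⟨z.re + z'.re, z.im + z'.im⟩⟩
instance : Neg (Complexification X) := ⟨fun z => ⟨-z.re, -z.im⟩⟩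
instance : Sub (Complexification X) := ⟨fun z z' => ⟨z.re - z'.re, z.im - z'.im⟩⟩

@[simp] theorem zero_re : (0 : Complexification X).re = 0 := rfl
@[simp] theorem zero_im : (0 : Complexification X).im = 0 := rfl
@[simp] theorem add_re (z z' : Complexification X) : (z + z').re = z.re + z'.re := rfl
@[simp] theorem add_im (z z' : Complexification X) : (z + z').im = z.im + z'.im := rfl
@[simp] theorem neg_re (z : Complexification X) : (-z).re = -z.re := rfl
@[simp] theorem neg_im (z : Complexification X) : (-z).im = -z.im := rfl
@[simp] theorem sub_re (z z' : Complexification X) : (z - z').re = z.re - z'.re := rfl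
@[simp] theorem sub_im (z z' : Complexification X) : (z - z').im = z.im - z'.im := rfl

instance : AddCommGroup (Complexification X) where
  add_assoc a b c := by ext <;> simp [add_assoc]
  zero_add a := by ext <;> simp
  add_zero a := by ext <;> simp
  add_comm a b := by ext <;> simp [add_comm]
  neg_add_cancel a := by ext <;> simp
  sub_eq_add_neg a b := by ext <;> simp [sub_eq_add_neg]
  nsmul := nsmulRec
  zsmul := zsmulRec

variable [Module ℝ X]

instance : SMul ℂ (Complexification X) :=
  ⟨fun c z => ⟨c.re • z.re - c.im • z.im, c.re • z.im + c.im • z.re⟩⟩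

@[simp] theorem smul_re (c : ℂ) (z : Complexification X) :
    (c • z).re = c.re • z.re - c.im • z.im := rfl
@[simp] theorem smul_im (c : ℂ) (z : Complexification X) :
    (c • z).im = c.re • z.im + c.im • z.re := rfl

instance : Module ℂ (Complexification X) where
  one_smul z := by ext <;> simp
  mul_smul a b z := by
    ext
    · simp only [smul_re, smul_im, Complex.mul_re, Complex.mul_im]; module
    · simp only [smul_re, smul_im, Complex.mul_re, Complex.mul_im]; module
  smul_zero a := by ext <;> simp
  smul_add a z z' := by
    ext
    · simp only [smul_re, add_re, add_im]; module
    · simp only [smul_im, add_re, add_im]; module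
  add_smul a b z := by
    ext
    · simp only [smul_re, add_re, Complex.add_re, Complex.add_im]; module
    · simp only [smul_im, add_im, Complex.add_re, Complex.add_im]; module
  zero_smul z := by ext <;> simp

/-- The canonical embedding of `X` into its complexification. -/
def ofReal (x : X) : Complexification X := ⟨x, 0⟩

end Algebra

variable {X : Type u} [AddCommGroup X] [Lattice X] [Module ℝ X]

/-- `m` is the modulus of `z = x + iy`, i.e. `m = sup_θ |cos θ x + sin θ y|`. -/
def IsModulus (z : Complexification X) (m : X) : Prop :=
  IsLUB (Set.range fun θ : ℝ => |Real.cos θ • z.re + Real.sin θ • z.im|) m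

/-- The relation `|z| ≤ u` for `z` in the complexification and `u` in `X`
(see `modulusLE_iff`; over an ru-complete `X` every modulus exists). -/
def ModulusLE (z : Complexification X) (u : X) : Prop :=
  ∀ θ : ℝ, |Real.cos θ • z.re + Real.sin θ • z.im| ≤ u

theorem modulusLE_iff {z : Complexification X} {m : X} (hm : IsModulus z m) (u : X) :
    ModulusLE z u ↔ m ≤ u := by
  rw [isLUB_le_iff hm]
  simp [ModulusLE, mem_upperBounds]

end Complexification

open Complexification

section Complex

variable {X : Type u} [AddCommGroup X] [Lattice X] [Module ℝ X]

/-- Relative uniform convergence in the complexification; regulators lie in `X`. -/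
def CRuTendsto {ι : Type*} (f : ι → Complexification X) (l : Filter ι)
    (z : Complexification X) : Prop :=
  ∃ u : X, ∀ ε : ℝ, 0 < ε → ∀ᶠ i in l, ModulusLE (f i - z) (ε • u)

/-- ru-continuity of `f : ℝ₊ → X_ℂ`: for some regulator function `u : ℝ₊ → X` and each `ε > 0`
there is a `δ > 0` that works for all `t`. Here `s = t + h` with `h ∈ [-min {δ, t}, δ]`. -/
def IsRuContinuous (f : ℝ≥0 → Complexification X) : Prop :=
  ∃ u : ℝ≥0 → X, ∀ ε : ℝ, 0 < ε → ∃ δ : ℝ, 0 < δ ∧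
    ∀ t s : ℝ≥0, |(s : ℝ) - (t : ℝ)| ≤ δ → ModulusLE (f s - f t) (ε • u t)

/-- A linear operator on `X_ℂ` is positive if it maps the cone `X₊` into itself. -/
def IsPositiveOp (T : Module.End ℂ (Complexification X)) : Prop :=
  ∀ x : X, 0 ≤ x → ∃ y : X, 0 ≤ y ∧ T (ofReal x) = ofReal y

/-- Relatively uniformly continuous positive semigroups. -/
structure IsPositiveRucSemigroup (T : ℝ≥0 → Module.End ℂ (Complexification X)) : Prop where
  map_zero : T 0 = 1
  map_add : ∀ s t : ℝ≥0, T (s + t) = T t * T s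
  ruContinuous : ∀ z : Complexification X, IsRuContinuous fun t => T t z
  positive : ∀ t : ℝ≥0, IsPositiveOp (T t)

/-- Exponential order boundedness with order exponent `w`. -/
def HasOrderExponent (T : ℝ≥0 → Module.End ℂ (Complexification X)) (w : ℝ) : Prop :=
  ∀ z : Complexification X, ∃ u : X, ∀ t : ℝ≥0,
    ModulusLE (T t z) (Real.exp (w * (t : ℝ)) • u)

/-- `A` is the generator of `T`: its graph consists of the pairs `(x, y)` such that
`(T(h)x - x)/h` converges relatively uniformly to `y` as `h ↘ 0`. -/
def IsGenerator (A : Complexification X →ₗ.[ℂ] Complexification X)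
    (T : ℝ≥0 → Module.End ℂ (Complexification X)) : Prop :=
  ∀ x y : Complexification X, (x, y) ∈ A.graph ↔
    CRuTendsto (fun h : ℝ≥0 => (((h : ℝ)⁻¹ : ℝ) : ℂ) • (T h x - x)) (𝓝[>] 0) y

/-- ru-closed operators. -/
def IsRuClosedOp (A : Complexification X →ₗ.[ℂ] Complexification X) : Prop :=
  ∀ (s : ℕ → A.domain) (x y : Complexification X),
    CRuTendsto (fun n => (s n : Complexification X)) atTop x →
    CRuTendsto (fun n => A (s n)) atTop y → ∃ hx : x ∈ A.domain, A ⟨x, hx⟩ = y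

/-- ru-densely defined operators. -/
def IsRuDenselyDefined (A : Complexification X →ₗ.[ℂ] Complexification X) : Prop :=
  ∀ x : Complexification X, ∃ s : ℕ → A.domain,
    CRuTendsto (fun n => (s n : Complexification X)) atTop x

/-- The operator `μ - A : D(A) → X_ℂ`. -/
def shifted (A : Complexification X →ₗ.[ℂ] Complexification X) (μ : ℂ) :
    A.domain →ₗ[ℂ] Complexification X :=
  μ • A.domain.subtype - A.toFun

/-- The set of `μ` for which `R(μ, A) = (μ - A)⁻¹` exists as an operator on `X_ℂ`. -/
def ruResolventSet (A : Complexification X →ₗ.[ℂ] Complexification X) : Set ℂ :=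
  {μ | Function.Bijective (shifted A μ)}

open Classical in
/-- The resolvent operator `R(μ, A) = (μ - A)⁻¹` (zero if `μ` is not in the resolvent set). -/
noncomputable def ruResolvent (A : Complexification X →ₗ.[ℂ] Complexification X) (μ : ℂ) :
    Module.End ℂ (Complexification X) :=
  if h : Function.Bijective (shifted A μ) then
    A.domain.subtype ∘ₗ (LinearEquiv.ofBijective (shifted A μ) h).symm.toLinearMap
  else 0

/-- The positive resolvent set `ρ₊(A)`: those `μ` for which `R(μ, A)` exists and is positive. -/
def positiveResolventSet (A : Complexification X →ₗ.[ℂ] Complexification X) : Set ℂ :=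
  {μ | μ ∈ ruResolventSet A ∧ IsPositiveOp (ruResolvent A μ)}

end Complex

end RuSemigroup

/-!
The theorem is a Hille–Yosida theorem for relatively uniform convergence. Both implications are
reduced to contraction semigroups on Banach spaces.

Let `F` be a family of positive operators on `X_ℂ` that contains the identity, and let `u` be in
`X`. The vectors `z` whose orbit under `F` is dominated by a multiple of `|u|` form a space
`orbitSpace F u`, normed by the least such multiple; it is a Banach space because `X` is
Archimedean and ru-complete. If all orbits of `F` are order bounded, then these spaces exhaust
`X_ℂ`, and every ru-convergence becomes a norm convergence in one of them
(`orbitSpace.tendsto_of_eventually`): if `|x n - x| ≤ ε v` and the orbit of `v` is dominated by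
`v'`, then `ε v'` dominates the orbit of `x n - x`.

From the semigroup to the resolvent, `F` consists of the operators `exp (-w t) T(t)`, which are
contractions on every orbit space. Each vector has a norm continuous orbit in some orbit space, and
there the resolvent of the generator is a Laplace transform
(`IsPositiveRucSemigroup.ruResolvent_eq_laplace`), which has norm at most `1 / (re μ - w)`. All
powers of the resolvent are thus estimated in a single orbit space, so the regulator depends
neither on the power nor on `μ`.

From the resolvent to the semigroup, `F` consists of the powers of `r R(w + r, A)` for `r > 0`. By
the resolvent identity each `s R(w + s, A)` is a contraction on the orbit spaces of this family
(`IsPositiveHilleYosida.orbitLE_normResolvent`), so the Yosida approximations generate contraction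
semigroups there, which converge on the vectors `z` with `n R(w + n, A) z → z`. Property `(D)`
enters only to show that every vector of `X_ℂ` is of this kind in some orbit space
(`IsPositiveHilleYosida.cRuTendsto_normResolvent`). The limits agree on intersections of orbit
spaces and glue to a semigroup on `X_ℂ`. Its generator extends `A`, and equals `A` since `w + 1`
lies in the resolvent set of `A` and is not an eigenvalue of the generator.
-/

set_option linter.unusedSectionVars false

namespace RuSemigroup

open Complexification

/-! ### Archimedean vector lattices and the modulus -/

section Lattice

variable {X : Type*} [AddCommGroup X] [Lattice X] [IsOrderedAddMonoid X] [Module ℝ X]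
  [IsOrderedModule ℝ X]

theorem IsArchimedean.nonpos_of_forall_le_smul (hX : IsArchimedean X) {x u : X}
    (h : ∀ ε : ℝ, 0 < ε → x ≤ ε • u) : x ≤ 0 := by
  have key : x ⊔ 0 = 0 := by
    refine hX (x ⊔ 0) |u| fun n => ⟨nsmul_nonneg le_sup_right n, ?_⟩
    rcases Nat.eq_zero_or_pos n with rfl | hn
    · simp
    have hn' : (0 : ℝ) < n := by exact_mod_cast hn
    have h1 : x ⊔ 0 ≤ (n : ℝ)⁻¹ • |u| := by
      refine sup_le ((h _ (inv_pos.2 hn')).trans ?_) (smul_nonneg (by positivity) (abs_nonneg u))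
      exact smul_le_smul_of_nonneg_left (le_abs_self u) (by positivity)
    have h2 := smul_le_smul_of_nonneg_left h1 hn'.le
    rwa [smul_inv_smul₀ hn'.ne', Nat.cast_smul_eq_nsmul] at h2
  exact sup_eq_right.1 key

theorem IsArchimedean.le_of_forall_le_add_smul (hX : IsArchimedean X) {x y u : X}
    (h : ∀ ε : ℝ, 0 < ε → x ≤ y + ε • u) : x ≤ y :=
  sub_nonpos.1 <| hX.nonpos_of_forall_le_smul (u := u) fun ε hε =>
    sub_le_iff_le_add'.2 (h ε hε)

/-- The modulus inequality in the form used throughout: `|z| ≤ u` if and only if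
`re (c z) ≤ ‖c‖ u` for all complex numbers `c`. -/
theorem modulusLE_iff_re {z : Complexification X} {u : X} :
    ModulusLE z u ↔ ∀ c : ℂ, (c • z).re ≤ ‖c‖ • u := by
  constructor
  · intro h c
    have h1 := smul_le_smul_of_nonneg_left ((le_abs_self _).trans (h (-c.arg))) (norm_nonneg c)
    have e : (c • z).re = ‖c‖ • (Real.cos (-c.arg) • z.re + Real.sin (-c.arg) • z.im) := by
      rw [Complexification.smul_re, smul_add, smul_smul, smul_smul, Real.cos_neg, Real.sin_neg,
        Complex.norm_mul_cos_arg, mul_neg, Complex.norm_mul_sin_arg, neg_smul, sub_eq_add_neg]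
    rwa [e]
  · intro h θ
    have hn : ‖(⟨Real.cos θ, -Real.sin θ⟩ : ℂ)‖ = 1 := by
      rw [← sq_eq_sq₀ (norm_nonneg _) zero_le_one, ← Complex.normSq_eq_norm_sq,
        Complex.normSq_mk]
      nlinarith [Real.cos_sq_add_sin_sq θ]
    refine abs_le'.2 ⟨?_, ?_⟩
    · simpa [hn] using h ⟨Real.cos θ, -Real.sin θ⟩
    · have := h (-⟨Real.cos θ, -Real.sin θ⟩)
      rw [norm_neg, hn, one_smul] at this
      simpa [add_comm] using this

end Lattice

namespace Complexification

section OfReal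

variable {X : Type*} [AddCommGroup X]

@[simp] theorem ofReal_re (x : X) : (ofReal x).re = x := rfl

@[simp] theorem ofReal_im (x : X) : (ofReal x).im = 0 := rfl

theorem ofReal_add (x y : X) : ofReal (x + y) = ofReal x + ofReal y := by ext <;> simp

theorem ofReal_sub (x y : X) : ofReal (x - y) = ofReal x - ofReal y := by ext <;> simp

variable [Module ℝ X]

@[simp] theorem real_smul_re (r : ℝ) (z : Complexification X) : (r • z).re = r • z.re := by
  rw [← Complex.coe_smul, smul_re, Complex.ofReal_re, Complex.ofReal_im, zero_smul, sub_zero]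

@[simp] theorem real_smul_im (r : ℝ) (z : Complexification X) : (r • z).im = r • z.im := by
  rw [← Complex.coe_smul, smul_im, Complex.ofReal_re, Complex.ofReal_im, zero_smul, add_zero]

theorem ofReal_smul (r : ℝ) (x : X) : ofReal (r • x) = (r : ℂ) • ofReal x := by ext <;> simp

theorem eq_ofReal_add_I_smul (z : Complexification X) :
    z = ofReal z.re + Complex.I • ofReal z.im := by ext <;> simp

end OfReal

section ModulusLE

variable {X : Type*} [AddCommGroup X] [Lattice X] [IsOrderedAddMonoid X] [Module ℝ X]
  [IsOrderedModule ℝ X] {z z' : Complexification X} {u v : X}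

theorem ModulusLE.nonneg (h : ModulusLE z u) : 0 ≤ u := (abs_nonneg _).trans (h 0)

theorem ModulusLE.mono (h : ModulusLE z u) (huv : u ≤ v) : ModulusLE z v :=
  fun θ => (h θ).trans huv

theorem ModulusLE.zero (hu : 0 ≤ u) : ModulusLE (0 : Complexification X) u :=
  modulusLE_iff_re.2 fun c => by simpa using smul_nonneg (norm_nonneg c) hu

theorem ModulusLE.add (h : ModulusLE z u) (h' : ModulusLE z' v) : ModulusLE (z + z') (u + v) := by
  rw [modulusLE_iff_re] at *
  intro c
  rw [smul_add, add_re, smul_add]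
  exact add_le_add (h c) (h' c)

theorem ModulusLE.smul (h : ModulusLE z u) (a : ℂ) : ModulusLE (a • z) (‖a‖ • u) := by
  rw [modulusLE_iff_re] at *
  intro c
  rw [smul_smul, smul_smul, ← norm_mul]
  exact h _

theorem ModulusLE.neg (h : ModulusLE z u) : ModulusLE (-z) u := by
  simpa using h.smul (-1)

theorem ModulusLE.sub (h : ModulusLE z u) (h' : ModulusLE z' v) : ModulusLE (z - z') (u + v) := by
  rw [sub_eq_add_neg]
  exact h.add h'.neg

theorem ModulusLE.abs_re (h : ModulusLE z u) : |z.re| ≤ u := by simpa using h 0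

theorem ModulusLE.abs_im (h : ModulusLE z u) : |z.im| ≤ u := by simpa using h (Real.pi / 2)

theorem modulusLE_ofReal {x : X} : ModulusLE (ofReal x) u ↔ |x| ≤ u := by
  refine ⟨fun h => h.abs_re, fun h => modulusLE_iff_re.2 fun c => ?_⟩
  have h1 : |c.re| • |x| ≤ ‖c‖ • u :=
    _root_.smul_le_smul (Complex.abs_re_le_norm c) h (abs_nonneg _) ((abs_nonneg x).trans h)
  refine le_trans ?_ h1
  simp only [smul_re, ofReal_re, ofReal_im, smul_zero, sub_zero]
  rcases le_total 0 c.re with hc | hc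
  · rw [abs_of_nonneg hc]
    exact smul_le_smul_of_nonneg_left (le_abs_self x) hc
  · rw [abs_of_nonpos hc, ← neg_smul_neg]
    exact smul_le_smul_of_nonneg_left (neg_le_abs x) (neg_nonneg.2 hc)

theorem ModulusLE.of_abs_re_abs_im (h : |z.re| ≤ u) (h' : |z.im| ≤ v) : ModulusLE z (u + v) := by
  rw [eq_ofReal_add_I_smul z]
  refine (modulusLE_ofReal.2 h).add ?_
  simpa using (modulusLE_ofReal.2 h').smul Complex.I

theorem exists_modulusLE (z : Complexification X) : ∃ u : X, ModulusLE z u :=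
  ⟨_, ModulusLE.of_abs_re_abs_im le_rfl le_rfl⟩

theorem ModulusLE.of_forall_add_smul (hX : IsArchimedean X)
    (h : ∀ ε : ℝ, 0 < ε → ModulusLE z (v + ε • u)) : ModulusLE z v :=
  fun θ => hX.le_of_forall_le_add_smul fun ε hε => h ε hε θ

theorem eq_zero_of_forall_modulusLE_smul (hX : IsArchimedean X)
    (h : ∀ ε : ℝ, 0 < ε → ModulusLE z (ε • u)) : z = 0 := by
  have h0 : ModulusLE z 0 := ModulusLE.of_forall_add_smul hX (u := u) (by simpa using h)
  have key : ∀ x : X, |x| ≤ 0 → x = 0 := fun x hx =>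
    le_antisymm ((le_abs_self x).trans hx) (neg_nonpos.1 ((neg_le_abs x).trans hx))
  ext
  · exact key _ h0.abs_re
  · exact key _ h0.abs_im

end ModulusLE

end Complexification

/-! ### Positive operators and relative uniform convergence -/

section PositiveOp

variable {X : Type*} [AddCommGroup X] [Lattice X] [IsOrderedAddMonoid X] [Module ℝ X]
  [IsOrderedModule ℝ X] {T S : Module.End ℂ (Complexification X)} {z : Complexification X} {u v : X}

theorem IsPositiveOp.im_apply_ofReal (hT : IsPositiveOp T) (x : X) : (T (ofReal x)).im = 0 := by
  obtain ⟨a, -, ha⟩ := hT (x ⊔ 0) le_sup_right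
  obtain ⟨b, -, hb⟩ := hT (-x ⊔ 0) le_sup_right
  have hx : x = (x ⊔ 0) - (-x ⊔ 0) := (posPart_sub_negPart x).symm
  rw [hx, ofReal_sub, map_sub, ha, hb]
  simp

theorem IsPositiveOp.apply_ofReal (hT : IsPositiveOp T) (x : X) :
    T (ofReal x) = ofReal (T (ofReal x)).re := by
  ext
  · rfl
  · exact hT.im_apply_ofReal x

theorem IsPositiveOp.re_apply (hT : IsPositiveOp T) (z : Complexification X) :
    (T z).re = (T (ofReal z.re)).re := by
  conv_lhs => rw [eq_ofReal_add_I_smul z, map_add, map_smul]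
  simp [hT.im_apply_ofReal]

theorem IsPositiveOp.im_apply (hT : IsPositiveOp T) (z : Complexification X) :
    (T z).im = (T (ofReal z.im)).re := by
  conv_lhs => rw [eq_ofReal_add_I_smul z, map_add, map_smul]
  simp [hT.im_apply_ofReal]

theorem IsPositiveOp.re_nonneg (hT : IsPositiveOp T) {x : X} (hx : 0 ≤ x) :
    0 ≤ (T (ofReal x)).re := by
  obtain ⟨y, hy, h⟩ := hT x hx
  simpa [h] using hy

theorem IsPositiveOp.re_mono (hT : IsPositiveOp T) {x y : X} (hxy : x ≤ y) :
    (T (ofReal x)).re ≤ (T (ofReal y)).re := by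
  have := hT.re_nonneg (sub_nonneg.2 hxy)
  rwa [ofReal_sub, map_sub, sub_re, sub_nonneg] at this

/-- A positive operator satisfies `|T z| ≤ T |z|`; here `u` bounds `|z|`, and `v` bounds `T u`. -/
theorem IsPositiveOp.modulusLE (hT : IsPositiveOp T) (hz : ModulusLE z u)
    (hu : ModulusLE (T (ofReal u)) v) : ModulusLE (T z) v := by
  refine ModulusLE.mono ?_ ((le_abs_self _).trans hu.abs_re)
  rw [modulusLE_iff_re] at *
  intro c
  rw [← map_smul, hT.re_apply]
  refine (hT.re_mono (hz c)).trans_eq ?_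
  rw [ofReal_smul, map_smul]
  simp

theorem IsPositiveOp.modulusLE_smul (hT : IsPositiveOp T) {ε : ℝ} (hε : 0 ≤ ε)
    (hz : ModulusLE z (ε • u)) (hu : ModulusLE (T (ofReal u)) v) : ModulusLE (T z) (ε • v) := by
  refine hT.modulusLE hz ?_
  rw [ofReal_smul, map_smul]
  simpa [abs_of_nonneg hε] using hu.smul (ε : ℂ)

theorem IsPositiveOp.one : IsPositiveOp (1 : Module.End ℂ (Complexification X)) :=
  fun x hx => ⟨x, hx, rfl⟩

theorem IsPositiveOp.mul (hT : IsPositiveOp T) (hS : IsPositiveOp S) : IsPositiveOp (T * S) := by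
  intro x hx
  obtain ⟨y, hy, h⟩ := hS x hx
  obtain ⟨y', hy', h'⟩ := hT y hy
  exact ⟨y', hy', by rw [Module.End.mul_apply, h, h']⟩

theorem IsPositiveOp.pow (hT : IsPositiveOp T) (n : ℕ) : IsPositiveOp (T ^ n) := by
  induction n with
  | zero => exact IsPositiveOp.one
  | succ n ih => exact ih.mul hT

theorem IsPositiveOp.smul (hT : IsPositiveOp T) {r : ℝ} (hr : 0 ≤ r) :
    IsPositiveOp ((r : ℂ) • T) := by
  intro x hx
  obtain ⟨y, hy, h⟩ := hT x hx
  exact ⟨r • y, smul_nonneg hr hy, by rw [LinearMap.smul_apply, h, ofReal_smul]⟩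

end PositiveOp

section Convergence

variable {X : Type*} [AddCommGroup X] [Lattice X] [IsOrderedAddMonoid X] [Module ℝ X]
  [IsOrderedModule ℝ X] {ι : Type*} {l : Filter ι} {f g : ι → Complexification X}
  {z z' : Complexification X}

theorem CRuTendsto.congr' (h : CRuTendsto f l z) (hfg : f =ᶠ[l] g) : CRuTendsto g l z := by
  obtain ⟨u, hu⟩ := h
  refine ⟨u, fun ε hε => ?_⟩
  filter_upwards [hu ε hε, hfg] with i hi hi'
  rwa [← hi']

theorem CRuTendsto.sub (h : CRuTendsto f l z) (h' : CRuTendsto g l z') :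
    CRuTendsto (fun i => f i - g i) l (z - z') := by
  obtain ⟨u, hu⟩ := h
  obtain ⟨v, hv⟩ := h'
  refine ⟨u + v, fun ε hε => ?_⟩
  filter_upwards [hu ε hε, hv ε hε] with i hi hi'
  rw [sub_sub_sub_comm, smul_add]
  exact hi.sub hi'

theorem CRuTendsto.smul (h : CRuTendsto f l z) (c : ℂ) :
    CRuTendsto (fun i => c • f i) l (c • z) := by
  obtain ⟨u, hu⟩ := h
  refine ⟨‖c‖ • u, fun ε hε => ?_⟩
  filter_upwards [hu ε hε] with i hi
  rw [← smul_sub, smul_comm]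
  exact hi.smul c

/-- Positive operators are ru-continuous. -/
theorem CRuTendsto.map {T : Module.End ℂ (Complexification X)} (hT : IsPositiveOp T)
    (h : CRuTendsto f l z) : CRuTendsto (fun i => T (f i)) l (T z) := by
  obtain ⟨u, hu⟩ := h
  obtain ⟨v, hv⟩ := exists_modulusLE (T (ofReal u))
  refine ⟨v, fun ε hε => ?_⟩
  filter_upwards [hu ε hε] with i hi
  rw [← map_sub]
  exact hT.modulusLE_smul hε.le hi hv

theorem CRuTendsto.unique [l.NeBot] (hX : IsArchimedean X) (h : CRuTendsto f l z)
    (h' : CRuTendsto f l z') : z = z' := by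
  obtain ⟨u, hu⟩ := h'.sub h
  refine sub_eq_zero.1 (eq_zero_of_forall_modulusLE_smul hX (u := u) fun ε hε => ?_)
  obtain ⟨i, hi⟩ := (hu ε hε).exists
  simpa using hi

theorem CRuTendsto.of_re_im {x y : X} (hx : RuTendsto (fun i => (f i).re) l x)
    (hy : RuTendsto (fun i => (f i).im) l y) : CRuTendsto f l ⟨x, y⟩ := by
  obtain ⟨u, hu⟩ := hx
  obtain ⟨v, hv⟩ := hy
  refine ⟨u + v, fun ε hε => ?_⟩
  filter_upwards [hu ε hε, hv ε hε] with i hi hi'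
  rw [smul_add]
  exact ModulusLE.of_abs_re_abs_im hi hi'

theorem CRuTendsto.re (h : CRuTendsto f l z) : RuTendsto (fun i => (f i).re) l z.re := by
  obtain ⟨u, hu⟩ := h
  exact ⟨u, fun ε hε => (hu ε hε).mono fun i hi => hi.abs_re⟩

theorem CRuTendsto.const (l : Filter ι) (z : Complexification X) :
    CRuTendsto (fun _ => z) l z :=
  ⟨0, fun ε _ => Eventually.of_forall fun _ => by
    rw [sub_self, smul_zero]
    exact ModulusLE.zero le_rfl⟩

theorem CRuTendsto.add (h : CRuTendsto f l z) (h' : CRuTendsto g l z') :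
    CRuTendsto (fun i => f i + g i) l (z + z') := by
  simpa using h.sub (((CRuTendsto.const l 0).sub h'))

theorem CRuTendsto.smul_of_tendsto {c : ι → ℂ} {c₀ : ℂ} (hc : Tendsto c l (𝓝 c₀))
    (h : CRuTendsto f l z) : CRuTendsto (fun i => c i • f i) l (c₀ • z) := by
  obtain ⟨u, hu⟩ := h
  obtain ⟨m, hm⟩ := exists_modulusLE z
  have hm0 := hm.nonneg
  refine ⟨(‖c₀‖ + 1) • u + m, fun ε hε => ?_⟩
  have h1 : ∀ᶠ i in l, ‖c i‖ < ‖c₀‖ + 1 := hc.norm.eventually (gt_mem_nhds (by linarith))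
  filter_upwards [hu ε hε, h1, Metric.tendsto_nhds.1 hc ε hε] with i hi hi1 hi2
  rw [dist_eq_norm] at hi2
  have e : c i • f i - c₀ • z = c i • (f i - z) + (c i - c₀) • z := by
    rw [smul_sub, sub_smul]
    abel
  rw [e, smul_add, smul_comm]
  refine ((hi.smul (c i)).mono ?_).add ((hm.smul (c i - c₀)).mono ?_)
  · exact smul_le_smul_of_nonneg_right hi1.le hi.nonneg
  · exact smul_le_smul_of_nonneg_right hi2.le hm0

end Convergence

/-! ### Banach spaces of vectors with order bounded orbits -/

section OrbitSpace

variable {X : Type*} [AddCommGroup X] [Lattice X] [IsOrderedAddMonoid X] [Module ℝ X]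
  [IsOrderedModule ℝ X]

/-- A family of positive operators on the complexification that contains the identity. -/
structure PositiveFamily (X : Type*) [AddCommGroup X] [Lattice X] [Module ℝ X] where
  /-- The operators of the family. -/
  carrier : Set (Module.End ℂ (Complexification X))
  one_mem : 1 ∈ carrier
  positive : ∀ S ∈ carrier, IsPositiveOp S

/-- `F.OrbitLE z v` says that the whole orbit of `z` under the family `F` has modulus at
most `v`. -/
def PositiveFamily.OrbitLE (F : PositiveFamily X) (z : Complexification X) (v : X) : Prop :=
  ∀ S ∈ F.carrier, ModulusLE (S z) v

theorem PositiveFamily.OrbitLE.modulusLE {F : PositiveFamily X} {z : Complexification X} {v : X}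
    (h : F.OrbitLE z v) : ModulusLE z v := h 1 F.one_mem

theorem PositiveFamily.OrbitLE.mono {F : PositiveFamily X} {z : Complexification X} {u v : X}
    (h : F.OrbitLE z u) (huv : u ≤ v) : F.OrbitLE z v := fun S hS => (h S hS).mono huv

theorem PositiveFamily.OrbitLE.smul {F : PositiveFamily X} {z : Complexification X} {v : X}
    (h : F.OrbitLE z v) (a : ℂ) : F.OrbitLE (a • z) (‖a‖ • v) := fun S hS => by
  rw [map_smul]
  exact (h S hS).smul a

theorem PositiveFamily.OrbitLE.add {F : PositiveFamily X} {z z' : Complexification X} {u v : X}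
    (h : F.OrbitLE z u) (h' : F.OrbitLE z' v) : F.OrbitLE (z + z') (u + v) := fun S hS => by
  rw [map_add]
  exact (h S hS).add (h' S hS)

/-- Elements dominated by `ε u` have orbits dominated by `ε v` if the orbit of `u` is dominated
by `v`. -/
theorem PositiveFamily.OrbitLE.of_modulusLE_smul {F : PositiveFamily X} {z : Complexification X}
    {u v : X} {ε : ℝ} (hu : F.OrbitLE (ofReal u) v) (hε : 0 ≤ ε) (hz : ModulusLE z (ε • u)) :
    F.OrbitLE z (ε • v) :=
  fun S hS => (F.positive S hS).modulusLE_smul hε hz (hu S hS)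

/-- The space of all `z` whose orbit under `F` is dominated by a multiple of `|u|`. It carries
the gauge norm, for which it is a Banach space when `X` is Archimedean and ru-complete. Using `|u|`
instead of `u` spares a sign condition on the regulator. -/
def orbitSpace (F : PositiveFamily X) (u : X) : Submodule ℂ (Complexification X) where
  carrier := {z | ∃ c : ℝ, 0 ≤ c ∧ F.OrbitLE z (c • |u|)}
  zero_mem' := ⟨0, le_rfl, fun S _ => by
    rw [map_zero, zero_smul]
    exact ModulusLE.zero le_rfl⟩
  add_mem' := by
    rintro z z' ⟨c, hc, h⟩ ⟨c', hc', h'⟩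
    refine ⟨c + c', add_nonneg hc hc', ?_⟩
    rw [add_smul]
    exact h.add h'
  smul_mem' := by
    rintro a z ⟨c, hc, h⟩
    refine ⟨‖a‖ * c, by positivity, ?_⟩
    rw [mul_smul]
    exact h.smul a

variable {F : PositiveFamily X} {u : X}

theorem PositiveFamily.OrbitLE.mem {z : Complexification X} {v : X} (h : F.OrbitLE z v) :
    z ∈ orbitSpace F v :=
  ⟨1, zero_le_one, h.mono (by simpa using le_abs_self v)⟩

theorem orbitSpace_mono {v : X} (h : |u| ≤ |v|) : orbitSpace F u ≤ orbitSpace F v :=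
  fun _ ⟨c, hc, hz⟩ => ⟨c, hc, hz.mono (smul_le_smul_of_nonneg_left h hc)⟩

namespace orbitSpace

noncomputable instance : Norm (orbitSpace F u) :=
  ⟨fun z => sInf {c : ℝ | 0 ≤ c ∧ F.OrbitLE (z : Complexification X) (c • |u|)}⟩

theorem norm_def (z : orbitSpace F u) :
    ‖z‖ = sInf {c : ℝ | 0 ≤ c ∧ F.OrbitLE (z : Complexification X) (c • |u|)} := rfl

theorem norm_nonneg' (z : orbitSpace F u) : 0 ≤ ‖z‖ := Real.sInf_nonneg fun _ h => h.1

theorem norm_le_of_orbitLE {z : orbitSpace F u} {c : ℝ} (hc : 0 ≤ c)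
    (h : F.OrbitLE (z : Complexification X) (c • |u|)) : ‖z‖ ≤ c :=
  csInf_le ⟨0, fun _ h => h.1⟩ ⟨hc, h⟩

variable [hX : Fact (IsArchimedean X)]

/-- By the Archimedean property the infimum defining the norm is attained. -/
theorem orbitLE_norm (z : orbitSpace F u) :
    F.OrbitLE (z : Complexification X) (‖z‖ • |u|) := by
  intro S hS
  refine ModulusLE.of_forall_add_smul hX.out (u := |u|) fun ε hε => ?_
  obtain ⟨c, ⟨-, hc⟩, hlt⟩ := exists_lt_of_csInf_lt
    (s := {c : ℝ | 0 ≤ c ∧ F.OrbitLE (z : Complexification X) (c • |u|)}) z.2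
    (show _ < ‖z‖ + ε by rw [← norm_def]; linarith)
  rw [← add_smul]
  exact (hc S hS).mono (smul_le_smul_of_nonneg_right hlt.le (abs_nonneg u))

theorem norm_le_iff {z : orbitSpace F u} {c : ℝ} (hc : 0 ≤ c) :
    ‖z‖ ≤ c ↔ F.OrbitLE (z : Complexification X) (c • |u|) :=
  ⟨fun h => (orbitLE_norm z).mono (smul_le_smul_of_nonneg_right h (abs_nonneg u)),
    norm_le_of_orbitLE hc⟩

theorem core : NormedSpace.Core ℂ (orbitSpace F u) where
  norm_nonneg := norm_nonneg'
  norm_smul := by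
    have key : ∀ (a : ℂ) (z : orbitSpace F u), ‖a • z‖ ≤ ‖a‖ * ‖z‖ := fun a z => by
      refine norm_le_of_orbitLE (mul_nonneg (norm_nonneg a) (norm_nonneg' z)) ?_
      rw [mul_smul]
      exact (orbitLE_norm z).smul a
    intro a z
    refine le_antisymm (key a z) ?_
    rcases eq_or_ne a 0 with rfl | ha
    · rw [norm_zero, zero_mul]
      exact norm_nonneg' _
    · have := key a⁻¹ (a • z)
      rw [inv_smul_smul₀ ha, norm_inv] at this
      rwa [← le_inv_mul_iff₀ (norm_pos_iff.2 ha)]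
  norm_triangle z z' := by
    refine norm_le_of_orbitLE (add_nonneg (norm_nonneg' z) (norm_nonneg' z')) ?_
    rw [add_smul]
    exact (orbitLE_norm z).add (orbitLE_norm z')
  norm_eq_zero_iff z := by
    constructor
    · intro h
      have h0 := (orbitLE_norm z).modulusLE
      rw [h, zero_smul] at h0
      exact Subtype.ext (eq_zero_of_forall_modulusLE_smul hX.out (u := 0) fun ε _ => by simpa)
    · rintro rfl
      refine le_antisymm (norm_le_of_orbitLE le_rfl fun S _ => ?_) (norm_nonneg' _)
      rw [zero_smul, ZeroMemClass.coe_zero, map_zero]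
      exact ModulusLE.zero le_rfl

noncomputable instance : NormedAddCommGroup (orbitSpace F u) := NormedAddCommGroup.ofCore core

noncomputable instance : NormedSpace ℂ (orbitSpace F u) := NormedSpace.ofCore core

theorem modulusLE_norm (z : orbitSpace F u) :
    ModulusLE (z : Complexification X) (‖z‖ • |u|) := (orbitLE_norm z).modulusLE

/-- Norm convergence in an orbit space implies ru-convergence with regulator `|u|`. -/
theorem cRuTendsto {ι : Type*} {l : Filter ι} {f : ι → orbitSpace F u} {z : orbitSpace F u}
    (h : Tendsto f l (𝓝 z)) :
    CRuTendsto (fun i => (f i : Complexification X)) l (z : Complexification X) := by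
  refine ⟨|u|, fun ε hε => ?_⟩
  filter_upwards [Metric.tendsto_nhds.1 h ε hε] with i hi
  rw [dist_eq_norm] at hi
  exact (modulusLE_norm (f i - z)).mono (smul_le_smul_of_nonneg_right hi.le (abs_nonneg u))

instance [hc : Fact (IsRuComplete X)] : CompleteSpace (orbitSpace F u) := by
  refine Metric.complete_of_cauchySeq_tendsto fun (s : ℕ → orbitSpace F u) hs => ?_
  have hs' : ∀ ε : ℝ, 0 < ε → ∃ N, ∀ n ≥ N, ∀ m ≥ N,
      F.OrbitLE ((s n : Complexification X) - s m) (ε • |u|) := by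
    intro ε hε
    obtain ⟨N, hN⟩ := Metric.cauchySeq_iff.1 hs ε hε
    refine ⟨N, fun n hn m hm => ?_⟩
    have := hN n hn m hm
    rw [dist_eq_norm] at this
    exact (norm_le_iff hε.le).1 this.le
  obtain ⟨x, hx⟩ := hc.out (fun n => (s n : Complexification X).re) ⟨|u|, fun ε hε =>
    (hs' ε hε).imp fun N hN n hn m hm => (hN n hn m hm).modulusLE.abs_re⟩
  obtain ⟨y, hy⟩ := hc.out (fun n => (s n : Complexification X).im) ⟨|u|, fun ε hε =>
    (hs' ε hε).imp fun N hN n hn m hm => (hN n hn m hm).modulusLE.abs_im⟩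
  set z : Complexification X := ⟨x, y⟩
  have hz : CRuTendsto (fun n => (s n : Complexification X)) atTop z :=
    CRuTendsto.of_re_im hx hy
  have lim : ∀ ε : ℝ, 0 < ε → ∃ N, ∀ n ≥ N,
      F.OrbitLE ((s n : Complexification X) - z) (ε • |u|) := by
    intro ε hε
    obtain ⟨N, hN⟩ := hs' ε hε
    refine ⟨N, fun n hn S hS => ?_⟩
    obtain ⟨v, hv⟩ := hz.map (F.positive S hS)
    refine ModulusLE.of_forall_add_smul hX.out (u := v) fun η hη => ?_
    obtain ⟨m, hm, hmN⟩ := ((hv η hη).and (eventually_ge_atTop N)).exists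
    have := (hN n hn m hmN S hS).add hm
    rwa [map_sub, sub_add_sub_cancel, ← map_sub] at this
  obtain ⟨N, hN⟩ := lim 1 one_pos
  have hmem : z ∈ orbitSpace F u := by
    have h1 : (s N : Complexification X) - z ∈ orbitSpace F u := ⟨1, zero_le_one, hN N le_rfl⟩
    simpa using (orbitSpace F u).sub_mem (s N).2 h1
  refine ⟨⟨z, hmem⟩, Metric.tendsto_atTop.2 fun ε hε => ?_⟩
  obtain ⟨N, hN⟩ := lim (ε / 2) (half_pos hε)
  refine ⟨N, fun n hn => ?_⟩
  rw [dist_eq_norm]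
  have h2 : ‖s n - ⟨z, hmem⟩‖ ≤ ε / 2 := norm_le_of_orbitLE (half_pos hε).le (hN n hn)
  linarith

/-- If the regulator of an ru-convergent family has its orbit dominated by `|u|`, the
convergence takes place in the norm of the orbit space of `u`. -/
theorem tendsto_of_eventually {ι : Type*} {l : Filter ι} {f : ι → orbitSpace F u}
    {z : orbitSpace F u} {v : X} (hv : F.OrbitLE (ofReal v) |u|)
    (h : ∀ ε : ℝ, 0 < ε → ∀ᶠ i in l,
      ModulusLE ((f i : Complexification X) - (z : Complexification X)) (ε • v)) :
    Tendsto f l (𝓝 z) := by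
  refine Metric.tendsto_nhds.2 fun ε hε => ?_
  filter_upwards [h (ε / 2) (half_pos hε)] with i hi
  rw [dist_eq_norm]
  have h2 : ‖f i - z‖ ≤ ε / 2 :=
    norm_le_of_orbitLE (half_pos hε).le (hv.of_modulusLE_smul (half_pos hε).le hi)
  linarith

/-- The inclusion of orbit spaces with comparable regulators, a contraction. -/
noncomputable def inclusion {v : X} (h : |u| ≤ |v|) : orbitSpace F u →L[ℂ] orbitSpace F v :=
  LinearMap.mkContinuous (Submodule.inclusion (orbitSpace_mono h)) 1 fun z => by
    rw [one_mul]
    exact norm_le_of_orbitLE (norm_nonneg z)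
      ((orbitLE_norm z).mono (smul_le_smul_of_nonneg_left h (norm_nonneg z)))

/-- The restriction to an orbit space of an operator that does not enlarge orbits. -/
noncomputable def restrict (T : Module.End ℂ (Complexification X))
    (hT : ∀ z v, F.OrbitLE z v → F.OrbitLE (T z) v) (u : X) :
    orbitSpace F u →L[ℂ] orbitSpace F u :=
  LinearMap.mkContinuous
    (LinearMap.restrict T fun _ ⟨c, hc, hz⟩ => ⟨c, hc, hT _ _ hz⟩) 1 fun z => by
    rw [one_mul]
    exact norm_le_of_orbitLE (norm_nonneg z) (hT _ _ (orbitLE_norm z))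

theorem norm_restrict_le (T : Module.End ℂ (Complexification X))
    (hT : ∀ z v, F.OrbitLE z v → F.OrbitLE (T z) v) (u : X) : ‖restrict T hT u‖ ≤ 1 :=
  LinearMap.mkContinuous_norm_le _ zero_le_one _

/-- The positive cone of an orbit space. -/
def positiveCone (F : PositiveFamily X) (u : X) : Set (orbitSpace F u) :=
  {z | ∃ x : X, 0 ≤ x ∧ (z : Complexification X) = ofReal x}

theorem isClosed_positiveCone : IsClosed (positiveCone F u) := by
  refine isClosed_of_closure_subset fun z hz => ?_
  obtain ⟨s, hs, hlim⟩ := mem_closure_iff_seq_limit.1 hz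
  choose x hx0 hx using hs
  obtain ⟨v, hv⟩ := cRuTendsto hlim
  simp only [hx] at hv
  have him : (z : Complexification X).im = 0 := by
    have key : ∀ a : X, (∀ ε : ℝ, 0 < ε → |a| ≤ ε • v) → a = 0 := fun a ha => by
      have h := hX.out.nonpos_of_forall_le_smul ha
      exact le_antisymm ((le_abs_self a).trans h) (neg_nonpos.1 ((neg_le_abs a).trans h))
    refine key _ fun ε hε => ?_
    obtain ⟨n, hn⟩ := (hv ε hε).exists
    have := hn.neg.abs_im
    simpa using this
  refine ⟨(z : Complexification X).re, ?_, ?_⟩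
  · refine neg_nonpos.1 (hX.out.nonpos_of_forall_le_smul (u := v) fun ε hε => ?_)
    obtain ⟨n, hn⟩ := (hv ε hε).exists
    have := (le_abs_self _).trans hn.abs_re
    rw [sub_re, ofReal_re] at this
    exact le_trans (by rw [sub_eq_add_neg]; exact le_add_of_nonneg_left (hx0 n)) this
  · ext
    · rfl
    · exact him

theorem add_mem_positiveCone {z z' : orbitSpace F u} (h : z ∈ positiveCone F u)
    (h' : z' ∈ positiveCone F u) : z + z' ∈ positiveCone F u := by
  obtain ⟨x, hx, e⟩ := h
  obtain ⟨x', hx', e'⟩ := h'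
  exact ⟨x + x', add_nonneg hx hx', by rw [Submodule.coe_add, e, e', ofReal_add]⟩

theorem smul_mem_positiveCone {z : orbitSpace F u} {r : ℝ} (hr : 0 ≤ r)
    (h : z ∈ positiveCone F u) : (r : ℂ) • z ∈ positiveCone F u := by
  obtain ⟨x, hx, e⟩ := h
  exact ⟨r • x, smul_nonneg hr hx, by rw [Submodule.coe_smul, e, ofReal_smul]⟩

end orbitSpace

end OrbitSpace

/-! ### Contraction semigroups on Banach spaces and their Laplace transforms -/

section ContractionSemigroup

open MeasureTheory

variable {E : Type*} [NormedAddCommGroup E] [NormedSpace ℂ E] {S : ℝ≥0 → E →L[ℂ] E}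

/-- A one-parameter semigroup of contractions. No continuity is assumed: the vectors with
continuous orbits are singled out by `IsContinuousVector`. -/
structure IsContractionSemigroup (S : ℝ≥0 → E →L[ℂ] E) : Prop where
  map_zero : S 0 = 1
  map_add : ∀ s t, S (s + t) = S t * S s
  norm_le : ∀ t, ‖S t‖ ≤ 1

/-- The orbit of `x` is continuous at `0`, hence everywhere. -/
def IsContinuousVector (S : ℝ≥0 → E →L[ℂ] E) (x : E) : Prop :=
  Tendsto (fun h => S h x) (𝓝 0) (𝓝 x)

/-- The orbit of `x` has the right derivative `y` at `0`, i.e. `x` lies in the domain of the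
generator, which maps it to `y`. -/
def HasOrbitDeriv (S : ℝ≥0 → E →L[ℂ] E) (x y : E) : Prop :=
  Tendsto (fun h : ℝ≥0 => (((h : ℝ)⁻¹ : ℝ) : ℂ) • (S h x - x)) (𝓝[>] 0) (𝓝 y)

namespace IsContractionSemigroup

theorem norm_apply_le (hS : IsContractionSemigroup S) (t : ℝ≥0) (x : E) : ‖S t x‖ ≤ ‖x‖ := by
  simpa using (S t).le_of_opNorm_le (hS.norm_le t) x

theorem apply_apply (hS : IsContractionSemigroup S) (s t : ℝ≥0) (x : E) :
    S s (S t x) = S (t + s) x := by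
  rw [hS.map_add]
  rfl

theorem apply_comm (hS : IsContractionSemigroup S) (s t : ℝ≥0) (x : E) :
    S s (S t x) = S t (S s x) := by
  rw [hS.apply_apply, hS.apply_apply, add_comm]

theorem norm_apply_sub_apply_le (hS : IsContractionSemigroup S) (s t : ℝ≥0) (x : E) :
    ‖S s x - S t x‖ ≤ ‖S (nndist s t) x - x‖ := by
  have key : ∀ s t : ℝ≥0, s ≤ t → ‖S t x - S s x‖ ≤ ‖S (nndist s t) x - x‖ := fun s t hst => by
    have hd : nndist s t = t - s := by
      ext
      rw [NNReal.coe_sub hst, coe_nndist, NNReal.dist_eq, abs_sub_comm,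
        abs_of_nonneg (sub_nonneg.2 (NNReal.coe_le_coe.2 hst))]
    have e : S t x = S s (S (t - s) x) := by rw [hS.apply_apply, tsub_add_cancel_of_le hst]
    rw [hd, e, ← map_sub]
    exact hS.norm_apply_le _ _
  rcases le_total s t with h | h
  · rw [norm_sub_rev]
    exact key s t h
  · rw [nndist_comm]
    exact key t s h

theorem continuous_orbit (hS : IsContractionSemigroup S) {x : E} (hx : IsContinuousVector S x) :
    Continuous fun t => S t x := by
  refine continuous_iff_continuousAt.2 fun t => tendsto_iff_norm_sub_tendsto_zero.2 ?_
  have h1 : Tendsto (fun s => nndist s t) (𝓝 t) (𝓝 0) := by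
    have : Continuous fun s : ℝ≥0 => nndist s t := by fun_prop
    simpa using this.tendsto t
  have h2 := (tendsto_iff_norm_sub_tendsto_zero.1 hx).comp h1
  exact squeeze_zero (fun _ => norm_nonneg _) (fun s => hS.norm_apply_sub_apply_le s t x) h2

theorem continuous_orbit_real (hS : IsContractionSemigroup S) {x : E}
    (hx : IsContinuousVector S x) : Continuous fun t : ℝ => S t.toNNReal x :=
  (hS.continuous_orbit hx).comp continuous_real_toNNReal

theorem isContinuousVector_apply (hS : IsContractionSemigroup S) {x : E}
    (hx : IsContinuousVector S x) (t : ℝ≥0) : IsContinuousVector S (S t x) := by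
  have := ((S t).continuous.tendsto x).comp hx
  exact this.congr fun h => hS.apply_comm t h x

/-- The continuous vectors form a closed set. -/
theorem isContinuousVector_of_tendsto (hS : IsContractionSemigroup S) {ι : Type*} {l : Filter ι}
    [l.NeBot] {f : ι → E} {x : E} (hf : ∀ i, IsContinuousVector S (f i))
    (hx : Tendsto f l (𝓝 x)) : IsContinuousVector S x := by
  refine Metric.tendsto_nhds.2 fun ε hε => ?_
  obtain ⟨i, hi⟩ := (Metric.tendsto_nhds.1 hx (ε / 3) (by positivity)).exists
  filter_upwards [Metric.tendsto_nhds.1 (hf i) (ε / 3) (by positivity)] with h hh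
  rw [dist_eq_norm] at *
  have e : S h x - x = (S h (f i) - f i) + (f i - x) - S h (f i - x) := by
    rw [map_sub]
    abel
  rw [e]
  have h1 := norm_sub_le ((S h (f i) - f i) + (f i - x)) (S h (f i - x))
  have h2 := norm_add_le (S h (f i) - f i) (f i - x)
  have h3 := hS.norm_apply_le h (f i - x)
  linarith

theorem _root_.RuSemigroup.HasOrbitDeriv.isContinuousVector {x y : E} (h0 : S 0 = 1)
    (h : HasOrbitDeriv S x y) : IsContinuousVector S x := by
  have h1 : Tendsto (fun h : ℝ≥0 => (h : ℂ)) (𝓝[>] 0) (𝓝 0) := by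
    have : Continuous fun h : ℝ≥0 => (h : ℂ) := by fun_prop
    simpa using (this.tendsto 0).mono_left nhdsWithin_le_nhds
  have h2 : Tendsto (fun h => S h x - x) (𝓝[>] 0) (𝓝 0) := by
    have := h1.smul h
    rw [zero_smul] at this
    refine this.congr' ?_
    filter_upwards [self_mem_nhdsWithin] with t ht
    rw [smul_smul, show ((t : ℂ)) = ((t : ℝ) : ℂ) from rfl, ← Complex.ofReal_mul,
      mul_inv_cancel₀ (NNReal.coe_ne_zero.2 (ne_of_gt ht)), Complex.ofReal_one, one_smul]
  have h3 : Tendsto (fun h => S h x) (𝓝[>] 0) (𝓝 x) := by simpa using h2.add_const x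
  have e : S 0 x = x := by rw [h0]; rfl
  have h4 : ContinuousWithinAt (fun h => S h x) (Set.Ioi 0) 0 := by
    rw [ContinuousWithinAt, e]
    exact h3
  rw [continuousWithinAt_Ioi_iff_Ici, show Set.Ici (0 : ℝ≥0) = Set.univ from Set.Ici_bot,
    continuousWithinAt_univ, ContinuousAt, e] at h4
  exact h4

/-- A right derivative of an orbit can be computed from an extension to the real line. -/
theorem _root_.RuSemigroup.HasOrbitDeriv.of_hasDerivAt {x y : E} {g : ℝ → E} (hg : HasDerivAt g y 0)
    (h0 : g 0 = x) (h : ∀ t : ℝ≥0, S t x = g t) : HasOrbitDeriv S x y := by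
  have h1 : Tendsto (fun h : ℝ≥0 => (h : ℝ)) (𝓝[>] 0) (𝓝[≠] 0) := by
    refine tendsto_nhdsWithin_iff.2 ⟨?_, ?_⟩
    · exact (NNReal.continuous_coe.tendsto 0).mono_left nhdsWithin_le_nhds
    · filter_upwards [self_mem_nhdsWithin] with t ht
      exact NNReal.coe_ne_zero.2 (ne_of_gt ht)
  refine ((hasDerivAt_iff_tendsto_slope_zero.1 hg).comp h1).congr fun t => ?_
  simp only [Function.comp_apply, zero_add, h, h0, Complex.coe_smul]

theorem hasDerivWithinAt_orbit (hS : IsContractionSemigroup S) {x y : E} (h : HasOrbitDeriv S x y)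
    {t : ℝ} (ht : 0 ≤ t) :
    HasDerivWithinAt (fun s : ℝ => S s.toNNReal x) (S t.toNNReal y) (Set.Ioi t) t := by
  rw [hasDerivWithinAt_iff_tendsto_slope' (by simp)]
  have h1 : Tendsto (fun s : ℝ => (s - t).toNNReal) (𝓝[>] t) (𝓝[>] 0) := by
    refine tendsto_nhdsWithin_iff.2 ⟨?_, ?_⟩
    · have : Continuous fun s : ℝ => (s - t).toNNReal := by fun_prop
      simpa using (this.tendsto t).mono_left nhdsWithin_le_nhds
    · filter_upwards [self_mem_nhdsWithin] with s hs
      exact Real.toNNReal_pos.2 (sub_pos.2 hs)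
  refine (((S t.toNNReal).continuous.tendsto y).comp (Tendsto.comp h h1)).congr' ?_
  filter_upwards [self_mem_nhdsWithin] with s hs
  have hs' : 0 ≤ s - t := (sub_pos.2 hs).le
  have e : s.toNNReal = (s - t).toNNReal + t.toNNReal := by
    rw [← Real.toNNReal_add hs' ht, sub_add_cancel]
  simp only [Function.comp_apply, slope_def_module, Real.coe_toNNReal _ hs']
  rw [map_smul, Complex.coe_smul, e, ← hS.apply_apply, map_sub]

variable [CompleteSpace E]

/-- Time averages of a continuous orbit lie in the domain of the generator. -/
theorem hasOrbitDeriv_integral (hS : IsContractionSemigroup S) {x : E}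
    (hx : IsContinuousVector S x) (a : ℝ≥0) :
    HasOrbitDeriv S (∫ t in (0 : ℝ)..a, S t.toNNReal x) (S a x - x) := by
  have hc := hS.continuous_orbit_real hx
  set φ : ℝ → E := fun t => S t.toNNReal x with hφ
  have h1 := (hc.integral_hasStrictDerivAt 0 (0 + a)).hasDerivAt.comp_add_const 0 (a : ℝ)
  have h2 := (hc.integral_hasStrictDerivAt 0 0).hasDerivAt
  have h3 := h1.sub h2
  have e1 : φ (0 + a) - φ 0 = S a x - x := by simp [hφ, hS.map_zero]
  rw [e1] at h3
  refine HasOrbitDeriv.of_hasDerivAt h3 (by simp) fun h => ?_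
  have e2 : S h (∫ t in (0 : ℝ)..a, φ t) = ∫ t in (0 : ℝ)..a, φ (t + h) := by
    rw [← ContinuousLinearMap.intervalIntegral_comp_comm _ (hc.intervalIntegrable _ _)]
    refine intervalIntegral.integral_congr fun t ht => ?_
    rw [Set.uIcc_of_le a.coe_nonneg] at ht
    simp only [hφ]
    rw [hS.apply_apply, Real.toNNReal_add ht.1 h.coe_nonneg, Real.toNNReal_coe]
  rw [e2, intervalIntegral.integral_comp_add_right, zero_add, add_comm (a : ℝ) h, Pi.sub_apply]
  exact (intervalIntegral.integral_interval_sub_left (hc.intervalIntegrable _ _)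
    (hc.intervalIntegrable _ _)).symm

/-- The time averages over shrinking intervals converge to the initial value. -/
theorem tendsto_average (hS : IsContractionSemigroup S) {x : E} (hx : IsContinuousVector S x) :
    Tendsto (fun n : ℕ => (((n : ℝ) + 1 : ℝ) : ℂ) •
      ∫ t in (0 : ℝ)..((1 / ((n : ℝ≥0) + 1) : ℝ≥0) : ℝ), S t.toNNReal x) atTop (𝓝 x) := by
  have hc := hS.continuous_orbit_real hx
  have h2 := hasDerivAt_iff_tendsto_slope_zero.1 (hc.integral_hasStrictDerivAt 0 0).hasDerivAt
  have h3 : Tendsto (fun n : ℕ => 1 / ((n : ℝ) + 1)) atTop (𝓝[≠] 0) :=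
    tendsto_nhdsWithin_iff.2 ⟨tendsto_one_div_add_atTop_nhds_zero_nat,
      Eventually.of_forall fun n => ne_of_gt (Nat.one_div_pos_of_nat)⟩
  have h4 := h2.comp h3
  simp only [Real.toNNReal_zero, hS.map_zero, one_apply_eq_self] at h4
  refine h4.congr fun n => ?_
  rw [Complex.coe_smul]
  simp

variable {l : ℂ}

/-- The Laplace transform `∫₀^∞ exp (-l t) S(t) x dt` of an orbit. -/
noncomputable def laplace (S : ℝ≥0 → E →L[ℂ] E) (l : ℂ) (x : E) : E :=
  ∫ t in Set.Ioi (0 : ℝ), Complex.exp (-l * t) • S t.toNNReal x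

theorem continuous_laplace_integrand (hS : IsContractionSemigroup S) {x : E}
    (hx : IsContinuousVector S x) (l : ℂ) :
    Continuous fun t : ℝ => Complex.exp (-l * t) • S t.toNNReal x := by
  exact (show Continuous fun t : ℝ => Complex.exp (-l * t) by fun_prop).smul
    (hS.continuous_orbit_real hx)

theorem norm_laplace_integrand_le (hS : IsContractionSemigroup S) (x : E) (l : ℂ) (t : ℝ) :
    ‖Complex.exp (-l * t) • S t.toNNReal x‖ ≤ Real.exp (-l.re * t) * ‖x‖ := by
  rw [norm_smul, Complex.norm_exp]
  refine mul_le_mul (le_of_eq (by simp)) (hS.norm_apply_le _ _) (norm_nonneg _) (Real.exp_pos _).le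

theorem integrableOn_bound (hl : 0 < l.re) (x : E) :
    IntegrableOn (fun t : ℝ => Real.exp (-l.re * t) * ‖x‖) (Set.Ioi 0) :=
  (exp_neg_integrableOn_Ioi 0 hl).mul_const _

theorem integrableOn_laplace (hS : IsContractionSemigroup S) {x : E}
    (hx : IsContinuousVector S x) (hl : 0 < l.re) :
    IntegrableOn (fun t : ℝ => Complex.exp (-l * t) • S t.toNNReal x) (Set.Ioi 0) :=
  Integrable.mono' (integrableOn_bound hl x)
    (hS.continuous_laplace_integrand hx l).aestronglyMeasurable
    (Eventually.of_forall fun t => hS.norm_laplace_integrand_le x l t)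

theorem tendsto_laplace (hS : IsContractionSemigroup S) {x : E} (hx : IsContinuousVector S x)
    (hl : 0 < l.re) {b : ℕ → ℝ} (hb : Tendsto b atTop atTop) :
    Tendsto (fun n : ℕ => ∫ t in (0 : ℝ)..b n, Complex.exp (-l * t) • S t.toNNReal x) atTop
      (𝓝 (laplace S l x)) :=
  intervalIntegral_tendsto_integral_Ioi 0 (hS.integrableOn_laplace hx hl) hb

theorem norm_laplace_le (hS : IsContractionSemigroup S) (hl : 0 < l.re) (x : E) :
    ‖laplace S l x‖ ≤ l.re⁻¹ * ‖x‖ := by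
  refine (norm_integral_le_of_norm_le (integrableOn_bound hl x)
    (Eventually.of_forall fun t => hS.norm_laplace_integrand_le x l t)).trans_eq ?_
  rw [integral_mul_const, integral_exp_mul_Ioi (by linarith)]
  simp

/-- The Laplace transform maps continuous vectors into the domain of the generator. -/
theorem hasOrbitDeriv_laplace (hS : IsContractionSemigroup S) {x : E}
    (hx : IsContinuousVector S x) (hl : 0 < l.re) :
    HasOrbitDeriv S (laplace S l x) (l • laplace S l x - x) := by
  have hc := hS.continuous_laplace_integrand hx l
  set ψ : ℝ → E := fun t => Complex.exp (-l * t) • S t.toNNReal x with hψ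
  set L := laplace S l x
  -- `S(h) L = exp (l h) (L - ∫₀^h ψ)`, whose derivative at `h = 0` is `l L - ψ(0)`.
  have hexp : HasDerivAt (fun h : ℝ => Complex.exp (l * h)) l 0 := by
    have h1 : HasDerivAt (fun h : ℝ => l * (h : ℂ)) (l * 1) 0 :=
      (Complex.ofRealCLM.hasDerivAt (x := (0 : ℝ))).const_mul l
    simpa using h1.cexp
  have h1 := hexp.smul ((hc.integral_hasStrictDerivAt 0 0).hasDerivAt.const_sub L)
  have e0 : ψ 0 = x := by simp [hψ, hS.map_zero]
  have h2 : HasDerivAt (fun h : ℝ => Complex.exp (l * h) • (L - ∫ t in (0 : ℝ)..h, ψ t))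
      (l • L - x) 0 := by
    refine h1.congr_deriv ?_
    simp [e0]
    abel
  refine HasOrbitDeriv.of_hasDerivAt h2 (by simp) fun h => ?_
  have hb := tendsto_natCast_atTop_atTop (R := ℝ)
  have lim1 := ((S h).continuous.tendsto _).comp (hS.tendsto_laplace hx hl hb)
  have lim2 := ((hS.tendsto_laplace hx hl (tendsto_atTop_add_const_right _ (h : ℝ) hb)).sub_const
    (∫ t in (0 : ℝ)..h, ψ t)).const_smul (Complex.exp (l * h))
  refine tendsto_nhds_unique lim1 (lim2.congr fun n => ?_)
  have e1 : S h (∫ t in (0 : ℝ)..n, ψ t) =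
      ∫ t in (0 : ℝ)..n, Complex.exp (l * h) • ψ (t + h) := by
    rw [← ContinuousLinearMap.intervalIntegral_comp_comm _ (hc.intervalIntegrable _ _)]
    refine intervalIntegral.integral_congr fun t ht => ?_
    rw [Set.uIcc_of_le n.cast_nonneg] at ht
    simp only [hψ]
    rw [map_smul, hS.apply_apply, Real.toNNReal_add ht.1 h.coe_nonneg, Real.toNNReal_coe, smul_smul,
      ← Complex.exp_add]
    congr 2
    push_cast
    ring
  rw [Function.comp_apply, e1, intervalIntegral.integral_smul,
    intervalIntegral.integral_comp_add_right, zero_add]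
  congr 1
  exact intervalIntegral.integral_interval_sub_left (hc.intervalIntegrable _ _)
    (hc.intervalIntegrable _ _)

/-- The Laplace transform inverts `l - A` on the domain of the generator `A`. -/
theorem laplace_smul_sub (hS : IsContractionSemigroup S) {x y : E} (h : HasOrbitDeriv S x y)
    (hl : 0 < l.re) : laplace S l (l • x - y) = x := by
  have hx := h.isContinuousVector hS.map_zero
  have hz : IsContinuousVector S (l • x - y) := by
    have hy : IsContinuousVector S y := by
      refine hS.isContinuousVector_of_tendsto (l := 𝓝[>] (0 : ℝ≥0)) (fun t => ?_) h
      have := ((hS.isContinuousVector_apply hx t).sub hx).const_smul (((t : ℝ)⁻¹ : ℝ) : ℂ)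
      exact this.congr fun s => by rw [map_smul, map_sub]
    have := (Tendsto.const_smul hx l).sub hy
    exact this.congr fun s => by rw [map_sub, map_smul]
  have hc := hS.continuous_laplace_integrand hz l
  have hb := tendsto_natCast_atTop_atTop (R := ℝ)
  -- `-exp (-l t) S(t) x` is an antiderivative of the integrand.
  have key : ∀ n : ℕ, (∫ t in (0 : ℝ)..n, Complex.exp (-l * t) • S t.toNNReal (l • x - y)) =
      x - Complex.exp (-l * n) • S (n : ℝ).toNNReal x := by
    intro n
    have h1 := intervalIntegral.integral_eq_sub_of_hasDeriv_right (a := 0) (b := (n : ℝ))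
      (f := fun t : ℝ => -(Complex.exp (-l * t) • S t.toNNReal x))
      (f' := fun t : ℝ => Complex.exp (-l * t) • S t.toNNReal (l • x - y))
      (hS.continuous_laplace_integrand hx l).neg.continuousOn (fun t ht => ?_)
      (hc.intervalIntegrable _ _)
    · rw [h1]
      simp [hS.map_zero]
      abel
    · rw [min_eq_left n.cast_nonneg] at ht
      have h2 : HasDerivAt (fun t : ℝ => Complex.exp (-l * t))
          (Complex.exp (-l * t) * (-l * 1)) t :=
        ((Complex.ofRealCLM.hasDerivAt (x := t)).const_mul (-l)).cexp
      have h3 := (h2.hasDerivWithinAt (s := Set.Ioi t)).smul (hS.hasDerivWithinAt_orbit h ht.1.le)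
      refine h3.neg.congr_deriv ?_
      rw [map_sub, map_smul, smul_sub, mul_one, mul_neg, neg_smul, smul_smul]
      abel
  have lim1 := (hS.tendsto_laplace hz hl hb).congr key
  have lim2 : Tendsto (fun n : ℕ => Complex.exp (-l * n) • S (n : ℝ).toNNReal x) atTop (𝓝 0) := by
    have h4 : Tendsto (fun n : ℕ => Real.exp (-l.re * n) * ‖x‖) atTop (𝓝 0) := by
      have h5 : Tendsto (fun n : ℕ => -l.re * (n : ℝ)) atTop atBot :=
        hb.const_mul_atTop_of_neg (by linarith)
      simpa using (Real.tendsto_exp_atBot.comp h5).mul_const ‖x‖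
    refine squeeze_zero_norm (fun n => ?_) h4
    simpa using hS.norm_laplace_integrand_le x l n
  have lim3 := lim2.const_sub x
  rw [sub_zero] at lim3
  exact tendsto_nhds_unique lim1 lim3

/-- Laplace transforms at real points preserve closed convex cones. -/
theorem laplace_mem (hS : IsContractionSemigroup S) {x : E} (hx : IsContinuousVector S x) {r : ℝ}
    (hr : 0 < r) {K : Set E} (hK : IsClosed K) (hadd : ∀ y ∈ K, ∀ z ∈ K, y + z ∈ K)
    (hsmul : ∀ a : ℝ, 0 ≤ a → ∀ y ∈ K, (a : ℂ) • y ∈ K) (h : ∀ t, S t x ∈ K) :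
    laplace S r x ∈ K := by
  have hb := tendsto_natCast_atTop_atTop (R := ℝ)
  refine hK.mem_of_tendsto (hS.tendsto_laplace hx (by simpa using hr) hb) ?_
  filter_upwards [eventually_gt_atTop 0] with n hn
  have hn' : (0 : ℝ) < n := by exact_mod_cast hn
  have hc := hS.continuous_laplace_integrand hx r
  have hconv : Convex ℝ K := by
    intro y hy z hz a b ha hb _
    rw [← Complex.coe_smul, ← Complex.coe_smul]
    exact hadd _ (hsmul a ha y hy) _ (hsmul b hb z hz)
  -- The integral over `(0, n]` is `n` times an average of elements of `K`.
  have h1 := hconv.set_average_mem hK (μ := volume) (t := Set.Ioc (0 : ℝ) n)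
    (f := fun t : ℝ => Complex.exp (-r * t) • S t.toNNReal x) (by simp [hn.ne']) (by simp)
    (Eventually.of_forall fun t => ?_) (hc.intervalIntegrable 0 n).1
  · rw [intervalIntegral.integral_of_le hn'.le]
    rw [setAverage_eq] at h1
    have h2 := hsmul n hn'.le _ h1
    rw [Complex.coe_smul] at h2
    simpa [hn'.ne'] using h2
  · have h3 := hsmul (Real.exp (-r * t)) (Real.exp_pos _).le _ (h t.toNNReal)
    simpa using h3

end IsContractionSemigroup

end ContractionSemigroup

/-! ### Yosida approximation and the generation of contraction semigroups -/

section Generation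

variable {E : Type*} [NormedAddCommGroup E] [NormedSpace ℂ E] {P : ℕ → E →L[ℂ] E}

/-- Contractions of the form `P n = n R(n)` for a pseudo-resolvent `R`; the last condition is the
resolvent identity. -/
structure IsContractionResolvent (P : ℕ → E →L[ℂ] E) : Prop where
  zero : P 0 = 0
  norm_le : ∀ n, ‖P n‖ ≤ 1
  resolvent : ∀ m n : ℕ, (m : ℂ) • P n - (n : ℂ) • P m = ((m : ℂ) - n) • (P n * P m)

/-- The Yosida approximation `n (n R(n) - 1)` of the generator. -/
noncomputable def yosida (P : ℕ → E →L[ℂ] E) (n : ℕ) : E →L[ℂ] E := (n : ℂ) • (P n - 1)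

/-- The uniformly continuous semigroup generated by the Yosida approximation. -/
noncomputable def yosidaExp (P : ℕ → E →L[ℂ] E) (n : ℕ) (t : ℝ) : E →L[ℂ] E :=
  NormedSpace.exp (t • yosida P n)

/-- The weights of the Poisson distribution with mean `a`. -/
noncomputable def poissonWeight (a : ℝ) (k : ℕ) : ℝ :=
  Real.exp (-a) * ((k.factorial : ℝ)⁻¹ * a ^ k)

theorem poissonWeight_nonneg {a : ℝ} (ha : 0 ≤ a) (k : ℕ) : 0 ≤ poissonWeight a k := by
  unfold poissonWeight
  positivity

theorem hasSum_poissonWeight (a : ℝ) : HasSum (poissonWeight a) 1 := by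
  have h := (NormedSpace.exp_series_hasSum_exp' (𝕂 := ℝ) a).mul_left (Real.exp (-a))
  rw [← Real.exp_eq_exp_ℝ, ← Real.exp_add, neg_add_cancel, Real.exp_zero] at h
  exact h

variable [CompleteSpace E]

/-- The semigroup of the Yosida approximation is a Poisson average of the powers of `P n`. -/
theorem hasSum_yosidaExp (P : ℕ → E →L[ℂ] E) (n : ℕ) (t : ℝ) :
    HasSum (fun k => poissonWeight (t * n) k • P n ^ k) (yosidaExp P n t) := by
  let : NormedAlgebra ℚ (E →L[ℂ] E) := NormedAlgebra.restrictScalars ℚ ℝ _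
  have h := (NormedSpace.exp_series_hasSum_exp' (𝕂 := ℝ) ((t * n) • P n)).const_smul
    (Real.exp (-(t * n)))
  have e : yosidaExp P n t = Real.exp (-(t * n)) • NormedSpace.exp ((t * n) • P n) := by
    have e1 : t • yosida P n = (t * n) • P n + algebraMap ℝ (E →L[ℂ] E) (-(t * n)) := by
      rw [yosida, Algebra.algebraMap_eq_smul_one, ← Complex.ofReal_natCast, Complex.coe_smul,
        smul_smul, smul_sub, neg_smul, sub_eq_add_neg]
    rw [yosidaExp, e1, NormedSpace.exp_add_of_commute (Algebra.commutes' _ _).symm,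
      ← NormedSpace.algebraMap_exp_comm, ← Real.exp_eq_exp_ℝ, ← Algebra.commutes,
      ← Algebra.smul_def]
  rw [e]
  refine h.congr_fun fun k => ?_
  rw [smul_pow, smul_smul, smul_smul, poissonWeight, mul_assoc]

theorem hasSum_yosidaExp_apply (P : ℕ → E →L[ℂ] E) (n : ℕ) (t : ℝ) (x : E) :
    HasSum (fun k => (poissonWeight (t * n) k : ℂ) • (P n ^ k) x) (yosidaExp P n t x) := by
  simpa using (hasSum_yosidaExp P n t).mapL (ContinuousLinearMap.apply ℂ E x)

/-- Yosida approximations are compatible with intertwining operators. -/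
theorem yosidaExp_intertwine {G : Type*} [NormedAddCommGroup G] [NormedSpace ℂ G] [CompleteSpace G]
    {Q : ℕ → G →L[ℂ] G} (j : E →L[ℂ] G) {n : ℕ} (hj : ∀ x, j (P n x) = Q n (j x)) (t : ℝ) (x : E) :
    j (yosidaExp P n t x) = yosidaExp Q n t (j x) := by
  have hk : ∀ k : ℕ, j ((P n ^ k) x) = (Q n ^ k) (j x) := by
    intro k
    induction k with
    | zero => simp
    | succ k ih => rw [pow_succ', pow_succ', mul_apply_eq_comp, hj, ih, mul_apply_eq_comp]
  refine HasSum.unique ?_ (hasSum_yosidaExp_apply Q n t (j x))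
  simpa only [map_smul, hk] using (hasSum_yosidaExp_apply P n t x).mapL j

/-- Closed convex cones that are invariant under the operators `P n` are invariant under the
semigroups of the Yosida approximations. -/
theorem yosidaExp_mem {K : Set E} (hK : IsClosed K) (h0 : 0 ∈ K)
    (hadd : ∀ y ∈ K, ∀ z ∈ K, y + z ∈ K) (hsmul : ∀ a : ℝ, 0 ≤ a → ∀ y ∈ K, (a : ℂ) • y ∈ K)
    {n : ℕ} (hP : ∀ x ∈ K, P n x ∈ K) {t : ℝ} (ht : 0 ≤ t) {x : E} (hx : x ∈ K) :
    yosidaExp P n t x ∈ K := by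
  have hk : ∀ k : ℕ, (P n ^ k) x ∈ K := by
    intro k
    induction k with
    | zero => simpa using hx
    | succ k ih =>
      rw [pow_succ', mul_apply_eq_comp]
      exact hP _ ih
  refine hK.mem_of_tendsto (hasSum_yosidaExp_apply P n t x) (Eventually.of_forall fun s => ?_)
  exact Finset.sum_induction _ (· ∈ K) (fun a b ha hb => hadd a ha b hb) h0 fun k _ =>
    hsmul _ (poissonWeight_nonneg (by positivity) k) _ (hk k)

theorem yosidaExp_zero (P : ℕ → E →L[ℂ] E) (n : ℕ) : yosidaExp P n 0 = 1 := by
  simp [yosidaExp]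

theorem yosidaExp_add (P : ℕ → E →L[ℂ] E) (n : ℕ) (s t : ℝ) :
    yosidaExp P n (s + t) = yosidaExp P n t * yosidaExp P n s := by
  let : NormedAlgebra ℚ (E →L[ℂ] E) := NormedAlgebra.restrictScalars ℚ ℝ _
  rw [yosidaExp, add_comm, add_smul, NormedSpace.exp_add_of_commute
    (((Commute.refl _).smul_left t).smul_right s)]
  rfl

theorem hasDerivAt_yosidaExp (P : ℕ → E →L[ℂ] E) (n : ℕ) (t : ℝ) :
    HasDerivAt (yosidaExp P n) (yosidaExp P n t * yosida P n) t :=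
  hasDerivAt_exp_smul_const (𝕂 := ℝ) (yosida P n) t

theorem hasDerivAt_clm_apply {G : ℝ → E →L[ℂ] E} {G' : E →L[ℂ] E} {s : ℝ}
    (h : HasDerivAt G G' s) (x : E) : HasDerivAt (fun s => G s x) (G' x) s :=
  ((ContinuousLinearMap.apply ℂ E x).restrictScalars ℝ).hasFDerivAt.comp_hasDerivAt s h

namespace IsContractionResolvent

theorem norm_apply_le (hP : IsContractionResolvent P) (n : ℕ) (x : E) : ‖P n x‖ ≤ ‖x‖ := by
  simpa using (P n).le_of_opNorm_le (hP.norm_le n) x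

theorem commute (hP : IsContractionResolvent P) (m n : ℕ) : Commute (P n) (P m) := by
  rcases eq_or_ne m n with rfl | hmn
  · exact Commute.refl _
  have h := hP.resolvent n m
  rw [← neg_sub, hP.resolvent m n, ← neg_smul, neg_sub] at h
  exact smul_right_injective _ (sub_ne_zero.2 (Nat.cast_injective.ne hmn.symm)) h

/-- The convergence `yosida P n (P m x) → yosida P m x` on continuous vectors rests on this form of
the resolvent identity. -/
theorem yosida_apply (hP : IsContractionResolvent P) (m n : ℕ) (x : E) :
    yosida P n (P m x) = P n (yosida P m x) := by
  have h := congrArg (fun T : E →L[ℂ] E => T x) (hP.resolvent m n)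
  simp only [sub_apply, smul_apply, mul_apply_eq_comp,
    sub_smul] at h
  simp only [yosida, sub_apply, smul_apply,
    one_apply_eq_self, map_smul, map_sub, smul_sub]
  rw [sub_eq_sub_iff_add_eq_add] at h ⊢
  rw [add_comm, h]

theorem commute_yosida_yosidaExp (hP : IsContractionResolvent P) (m n : ℕ) (t : ℝ) :
    Commute (yosida P n) (yosidaExp P m t) := by
  let : NormedAlgebra ℚ (E →L[ℂ] E) := NormedAlgebra.restrictScalars ℚ ℝ _
  refine Commute.exp_right (Commute.smul_right ?_ t)
  refine Commute.smul_right (Commute.smul_left ?_ _) _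
  exact ((hP.commute m n).sub_left (Commute.one_left _)).sub_right (Commute.one_right _)

theorem commute_yosidaExp (hP : IsContractionResolvent P) (m n : ℕ) (t : ℝ) :
    Commute (P n) (yosidaExp P m t) := by
  let : NormedAlgebra ℚ (E →L[ℂ] E) := NormedAlgebra.restrictScalars ℚ ℝ _
  refine Commute.exp_right (Commute.smul_right (Commute.smul_right ?_ _) t)
  exact (hP.commute m n).sub_right (Commute.one_right _)

theorem norm_pow_apply_le (hP : IsContractionResolvent P) (n k : ℕ) (x : E) :
    ‖(P n ^ k) x‖ ≤ ‖x‖ := by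
  induction k with
  | zero => simp
  | succ k ih =>
    rw [pow_succ', mul_apply_eq_comp]
    exact (hP.norm_apply_le n _).trans ih

theorem norm_yosidaExp_le (hP : IsContractionResolvent P) (n : ℕ) {t : ℝ} (ht : 0 ≤ t) (x : E) :
    ‖yosidaExp P n t x‖ ≤ ‖x‖ := by
  have h := (hasSum_poissonWeight (t * n)).mul_right ‖x‖
  rw [one_mul] at h
  refine (hasSum_yosidaExp_apply P n t x).norm_le_of_bounded h fun k => ?_
  have hw := poissonWeight_nonneg (a := t * n) (by positivity) k
  rw [norm_smul, Complex.norm_real, Real.norm_of_nonneg hw]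
  exact mul_le_mul_of_nonneg_left (hP.norm_pow_apply_le n k x) hw

theorem norm_yosidaExp_sub_le (hP : IsContractionResolvent P) (m n : ℕ) {t : ℝ} (ht : 0 ≤ t)
    (x : E) : ‖yosidaExp P n t x - yosidaExp P m t x‖ ≤ ‖yosida P n x - yosida P m x‖ * t := by
  -- Differentiate `s ↦ exp (s Aₙ) exp ((t - s) Aₘ) x`, which interpolates between the two terms.
  have hd : ∀ s : ℝ, HasDerivAt (fun s => yosidaExp P n s * yosidaExp P m (t - s))
      (yosidaExp P n s * (yosidaExp P m (t - s) * (yosida P n - yosida P m))) s := by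
    intro s
    have h1 := (hasDerivAt_yosidaExp P m (t - s)).comp_const_sub t s
    refine ((hasDerivAt_yosidaExp P n s).mul h1).congr_deriv ?_
    rw [mul_sub, mul_sub, ← (hP.commute_yosida_yosidaExp m n (t - s)).eq]
    noncomm_ring
  have hd' : ∀ s : ℝ, HasDerivAt (fun s => yosidaExp P n s (yosidaExp P m (t - s) x))
      (yosidaExp P n s (yosidaExp P m (t - s) (yosida P n x - yosida P m x))) s := fun s =>
    hasDerivAt_clm_apply (hd s) x
  have := norm_image_sub_le_of_norm_deriv_le_segment' (a := 0) (b := t)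
    (fun s _ => (hd' s).hasDerivWithinAt) (C := ‖yosida P n x - yosida P m x‖)
    (fun s hs => (hP.norm_yosidaExp_le n hs.1 _).trans
      (hP.norm_yosidaExp_le m (sub_nonneg.2 hs.2.le) _)) t ⟨ht, le_rfl⟩
  simpa [yosidaExp_zero] using this

/-- This is the case `m = 0` of the preceding estimate, as `yosida P 0 = 0`. -/
theorem norm_yosidaExp_sub_self_le (hP : IsContractionResolvent P) (n : ℕ) {t : ℝ} (ht : 0 ≤ t)
    (x : E) : ‖yosidaExp P n t x - x‖ ≤ ‖yosida P n x‖ * t := by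
  simpa [yosida, yosidaExp] using hP.norm_yosidaExp_sub_le 0 n ht x

/-- First order expansion of the approximating semigroups, with an error controlled by a vector
`b` that can be chosen close to `yosida P n x`. -/
theorem norm_yosidaExp_sub_sub_le (hP : IsContractionResolvent P) (n : ℕ) {t : ℝ} (ht : 0 ≤ t)
    (x b : E) : ‖yosidaExp P n t x - x - t • yosida P n x‖ ≤
      (2 * ‖yosida P n x - b‖ + ‖yosida P n b‖ * t) * t := by
  have hd : ∀ s : ℝ, HasDerivAt (fun s => yosidaExp P n s x - s • yosida P n x)
      (yosidaExp P n s (yosida P n x) - yosida P n x) s := fun s => by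
    have h1 := hasDerivAt_clm_apply (hasDerivAt_yosidaExp P n s) x
    have h2 := (hasDerivAt_id s).smul_const (yosida P n x)
    rw [one_smul] at h2
    exact h1.sub h2
  have hb : ∀ s ∈ Set.Ico 0 t, ‖yosidaExp P n s (yosida P n x) - yosida P n x‖ ≤
      2 * ‖yosida P n x - b‖ + ‖yosida P n b‖ * t := by
    intro s hs
    set a := yosida P n x
    have e : yosidaExp P n s a - a =
        yosidaExp P n s (a - b) + (yosidaExp P n s b - b) - (a - b) := by
      rw [map_sub]
      abel
    rw [e]
    have h1 := hP.norm_yosidaExp_le n hs.1 (a - b)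
    have h2 := hP.norm_yosidaExp_sub_self_le n hs.1 b
    have h3 := mul_le_mul_of_nonneg_left hs.2.le (norm_nonneg (yosida P n b))
    have h4 := norm_sub_le (yosidaExp P n s (a - b) + (yosidaExp P n s b - b)) (a - b)
    have h5 := norm_add_le (yosidaExp P n s (a - b)) (yosidaExp P n s b - b)
    linarith
  have := norm_image_sub_le_of_norm_deriv_le_segment' (a := 0) (b := t)
    (fun s _ => (hd s).hasDerivWithinAt) hb t ⟨ht, le_rfl⟩
  simpa [yosidaExp_zero, sub_right_comm] using this

end IsContractionResolvent

/-- The vectors `x` with `P n x → x`: the closure of the domain of the generator. -/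
def continuousVectors (P : ℕ → E →L[ℂ] E) : Submodule ℂ E where
  carrier := {x | Tendsto (fun n => P n x) atTop (𝓝 x)}
  zero_mem' := by simp
  add_mem' {x y} hx hy := by
    have : Tendsto (fun n => P n x + P n y) atTop (𝓝 (x + y)) := Tendsto.add hx hy
    simpa using this
  smul_mem' c x hx := by
    have : Tendsto (fun n => c • P n x) atTop (𝓝 (c • x)) := Tendsto.const_smul hx c
    simpa using this

namespace IsContractionResolvent

theorem apply_mem_continuousVectors (hP : IsContractionResolvent P) (m : ℕ) {x : E}
    (hx : x ∈ continuousVectors P) : P m x ∈ continuousVectors P := by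
  have h : Tendsto (fun n => P m (P n x)) atTop (𝓝 (P m x)) := ((P m).continuous.tendsto x).comp hx
  refine h.congr fun n => ?_
  rw [← mul_apply_eq_comp, ← mul_apply_eq_comp, (hP.commute m n).eq]

theorem tendsto_yosida (hP : IsContractionResolvent P) (m : ℕ) {x : E}
    (hx : x ∈ continuousVectors P) :
    Tendsto (fun n => yosida P n (P m x)) atTop (𝓝 (yosida P m x)) := by
  have h : yosida P m x ∈ continuousVectors P :=
    Submodule.smul_mem _ _ (Submodule.sub_mem _ (hP.apply_mem_continuousVectors m hx) hx)
  exact Tendsto.congr (fun n => (hP.yosida_apply m n x).symm) h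

theorem cauchySeq_yosidaExp (hP : IsContractionResolvent P) {t : ℝ} (ht : 0 ≤ t) {x : E}
    (hx : x ∈ continuousVectors P) : CauchySeq fun n => yosidaExp P n t x := by
  refine Metric.cauchySeq_iff.2 fun ε hε => ?_
  obtain ⟨k, hk⟩ := (Metric.tendsto_nhds.1 hx (ε / 4) (by positivity)).exists
  rw [dist_eq_norm'] at hk
  obtain ⟨N, hN⟩ := Metric.cauchySeq_iff.1 (hP.tendsto_yosida k hx).cauchySeq (ε / (2 * (t + 1)))
    (by positivity)
  refine ⟨N, fun m hm n hn => ?_⟩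
  have h1 := (hP.norm_yosidaExp_sub_le n m ht (P k x)).trans
    (mul_le_mul_of_nonneg_right (((dist_eq_norm _ _).symm.trans_lt (hN m hm n hn)).le) ht)
  have h2 : ε / (2 * (t + 1)) * t ≤ ε / 2 := by
    rw [div_mul_eq_mul_div, div_le_div_iff₀ (by positivity) (by positivity)]
    nlinarith
  have e : yosidaExp P m t x - yosidaExp P n t x = yosidaExp P m t (x - P k x) +
      (yosidaExp P m t (P k x) - yosidaExp P n t (P k x)) - yosidaExp P n t (x - P k x) := by
    rw [map_sub, map_sub]
    abel
  rw [dist_eq_norm, e]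
  have h3 := norm_sub_le (yosidaExp P m t (x - P k x) +
      (yosidaExp P m t (P k x) - yosidaExp P n t (P k x))) (yosidaExp P n t (x - P k x))
  have h4 := norm_add_le (yosidaExp P m t (x - P k x))
      (yosidaExp P m t (P k x) - yosidaExp P n t (P k x))
  have h5 := hP.norm_yosidaExp_le m ht (x - P k x)
  have h6 := hP.norm_yosidaExp_le n ht (x - P k x)
  linarith

/-- The limit of the Yosida semigroups at time `t`. -/
noncomputable def limit (hP : IsContractionResolvent P) (t : ℝ≥0) (x : continuousVectors P) : E :=
  (cauchySeq_tendsto_of_complete (hP.cauchySeq_yosidaExp t.coe_nonneg x.2)).choose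

theorem tendsto_limit (hP : IsContractionResolvent P) (t : ℝ≥0) (x : continuousVectors P) :
    Tendsto (fun n => yosidaExp P n t x) atTop (𝓝 (hP.limit t x)) :=
  (cauchySeq_tendsto_of_complete (hP.cauchySeq_yosidaExp t.coe_nonneg x.2)).choose_spec

theorem norm_limit_le (hP : IsContractionResolvent P) (t : ℝ≥0) (x : continuousVectors P) :
    ‖hP.limit t x‖ ≤ ‖x‖ :=
  le_of_tendsto (hP.tendsto_limit t x).norm
    (Eventually.of_forall fun n => hP.norm_yosidaExp_le n t.coe_nonneg x)

theorem limit_mem (hP : IsContractionResolvent P) (t : ℝ≥0) (x : continuousVectors P) :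
    hP.limit t x ∈ continuousVectors P := by
  refine tendsto_iff_norm_sub_tendsto_zero.2 (squeeze_zero (fun _ => norm_nonneg _) (fun k => ?_)
    (tendsto_iff_norm_sub_tendsto_zero.1 x.2))
  have h := (((P k).continuous.tendsto _).comp (hP.tendsto_limit t x)).sub (hP.tendsto_limit t x)
  refine le_of_tendsto h.norm (Eventually.of_forall fun n => ?_)
  rw [Function.comp_apply, ← mul_apply_eq_comp, (hP.commute_yosidaExp n k t).eq,
    mul_apply_eq_comp, ← map_sub]
  exact hP.norm_yosidaExp_le n t.coe_nonneg _

/-- The contraction semigroup generated by a contraction resolvent, on the closure of the domain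
of the generator. -/
noncomputable def limitSemigroup (hP : IsContractionResolvent P) (t : ℝ≥0) :
    continuousVectors P →L[ℂ] continuousVectors P :=
  LinearMap.mkContinuous
    { toFun := fun x => ⟨hP.limit t x, hP.limit_mem t x⟩
      map_add' := fun x y => Subtype.ext <|
        tendsto_nhds_unique (hP.tendsto_limit t (x + y)) <| by
          simpa using (hP.tendsto_limit t x).add (hP.tendsto_limit t y)
      map_smul' := fun c x => Subtype.ext <|
        tendsto_nhds_unique (hP.tendsto_limit t (c • x)) <| by
          simpa using (hP.tendsto_limit t x).const_smul c } 1 fun x => by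
    rw [one_mul]
    exact hP.norm_limit_le t x

theorem tendsto_limitSemigroup (hP : IsContractionResolvent P) (t : ℝ≥0)
    (x : continuousVectors P) :
    Tendsto (fun n => yosidaExp P n t x) atTop (𝓝 (hP.limitSemigroup t x)) :=
  hP.tendsto_limit t x

theorem isContractionSemigroup (hP : IsContractionResolvent P) :
    IsContractionSemigroup hP.limitSemigroup where
  map_zero := by
    ext x
    refine tendsto_nhds_unique (hP.tendsto_limitSemigroup 0 x) ?_
    simp [yosidaExp_zero]
  map_add s t := by
    ext x
    refine tendsto_nhds_unique (hP.tendsto_limitSemigroup (s + t) x) ?_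
    have h1 := hP.tendsto_limitSemigroup t (hP.limitSemigroup s x)
    have h2 : Tendsto (fun n => yosidaExp P n t (yosidaExp P n s x - hP.limitSemigroup s x)) atTop
        (𝓝 0) :=
      squeeze_zero_norm (fun n => hP.norm_yosidaExp_le n t.coe_nonneg _)
        (tendsto_iff_norm_sub_tendsto_zero.1 (hP.tendsto_limitSemigroup s x))
    have h3 := h2.add h1
    rw [zero_add] at h3
    refine h3.congr fun n => ?_
    rw [map_sub, sub_add_cancel, NNReal.coe_add, yosidaExp_add]
    rfl
  norm_le t := LinearMap.mkContinuous_norm_le _ zero_le_one _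

theorem norm_limitSemigroup_sub_self_le (hP : IsContractionResolvent P) (t : ℝ≥0) (k : ℕ)
    (x : continuousVectors P) :
    ‖hP.limitSemigroup t x - x‖ ≤ 2 * ‖P k x - x‖ + ‖yosida P k x‖ * t := by
  refine le_of_tendsto ((hP.tendsto_limitSemigroup t x).sub_const (x : E)).norm
    (Eventually.of_forall fun n => ?_)
  have e : yosidaExp P n t x - x = (yosidaExp P n t (P k x) - P k x) + (P k x - x) -
      yosidaExp P n t (P k x - x) := by
    rw [map_sub]
    abel
  rw [e]
  have h1 := norm_sub_le ((yosidaExp P n t (P k x) - P k x) + (P k x - x))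
    (yosidaExp P n t (P k x - x))
  have h2 := norm_add_le (yosidaExp P n t (P k x) - P k x) (P k x - (x : E))
  have h3 := hP.norm_yosidaExp_le n t.coe_nonneg (P k x - (x : E))
  have h4 := hP.norm_yosidaExp_sub_self_le n t.coe_nonneg (P k x)
  rw [hP.yosida_apply] at h4
  have h5 := mul_le_mul_of_nonneg_right (hP.norm_apply_le n (yosida P k x)) t.coe_nonneg
  linarith

theorem isContinuousVector (hP : IsContractionResolvent P) (x : continuousVectors P) :
    IsContinuousVector hP.limitSemigroup x := by
  refine tendsto_iff_norm_sub_tendsto_zero.2 (Metric.tendsto_nhds.2 fun ε hε => ?_)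
  obtain ⟨k, hk⟩ := (Metric.tendsto_nhds.1 x.2 (ε / 4) (by positivity)).exists
  rw [dist_eq_norm] at hk
  have h1 : Tendsto (fun t : ℝ≥0 => ‖yosida P k x‖ * (t : ℝ)) (𝓝 0) (𝓝 0) := by
    have : Continuous fun t : ℝ≥0 => ‖yosida P k x‖ * (t : ℝ) := by fun_prop
    simpa using this.tendsto 0
  filter_upwards [h1.eventually (gt_mem_nhds (half_pos hε))] with t ht
  rw [Real.dist_0_eq_abs, abs_of_nonneg (norm_nonneg _)]
  have h2 := hP.norm_limitSemigroup_sub_self_le t k x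
  linarith

/-- On the range of `P m`, the generator of the limit semigroup is `P m x ↦ yosida P m x`. -/
theorem hasOrbitDeriv (hP : IsContractionResolvent P) (m : ℕ) (x : continuousVectors P) :
    HasOrbitDeriv hP.limitSemigroup ⟨P m x, hP.apply_mem_continuousVectors m x.2⟩
      ⟨yosida P m x, Submodule.smul_mem _ _
        (Submodule.sub_mem _ (hP.apply_mem_continuousVectors m x.2) x.2)⟩ := by
  set y : continuousVectors P := ⟨P m x, hP.apply_mem_continuousVectors m x.2⟩
  set a : continuousVectors P := ⟨yosida P m x, Submodule.smul_mem _ _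
        (Submodule.sub_mem _ (hP.apply_mem_continuousVectors m x.2) x.2)⟩
  -- Let `n → ∞` in the first order expansion, with `b = P k a` as the auxiliary vector.
  have key : ∀ (t : ℝ≥0) (k : ℕ), ‖hP.limitSemigroup t y - y - (t : ℝ) • a‖ ≤
      (2 * ‖P k a - a‖ + ‖yosida P k a‖ * t) * t := by
    intro t k
    have l1 := hP.tendsto_yosida m x.2
    have l2 :=
      (((hP.tendsto_limitSemigroup t y).sub_const (y : E)).sub (l1.const_smul (t : ℝ))).norm
    have l3 : Tendsto (fun n => (2 * ‖yosida P n (P m x) - P k a‖ + ‖yosida P k a‖ * (t : ℝ)) * t)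
        atTop (𝓝 ((2 * ‖(a : E) - P k a‖ + ‖yosida P k a‖ * (t : ℝ)) * t)) :=
      ((((l1.sub_const (P k a)).norm).const_mul 2).add_const _).mul_const _
    rw [norm_sub_rev (a : E)] at l3
    refine le_of_tendsto_of_tendsto' l2 l3 fun n => ?_
    refine (hP.norm_yosidaExp_sub_sub_le n t.coe_nonneg (P m x) (P k a)).trans ?_
    refine mul_le_mul_of_nonneg_right ?_ t.coe_nonneg
    refine add_le_add_right (mul_le_mul_of_nonneg_right ?_ t.coe_nonneg) _
    rw [hP.yosida_apply]
    exact hP.norm_apply_le n _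
  refine tendsto_iff_norm_sub_tendsto_zero.2 (Metric.tendsto_nhds.2 fun ε hε => ?_)
  obtain ⟨k, hk⟩ := (Metric.tendsto_nhds.1 a.2 (ε / 4) (by positivity)).exists
  rw [dist_eq_norm] at hk
  have h1 : Tendsto (fun t : ℝ≥0 => ‖yosida P k a‖ * (t : ℝ)) (𝓝[>] 0) (𝓝 0) := by
    have : Continuous fun t : ℝ≥0 => ‖yosida P k a‖ * (t : ℝ) := by fun_prop
    simpa using (this.tendsto 0).mono_left nhdsWithin_le_nhds
  filter_upwards [h1.eventually (gt_mem_nhds (half_pos hε)), self_mem_nhdsWithin] with t ht ht0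
  have ht' : (0 : ℝ) < t := NNReal.coe_pos.2 ht0
  rw [Real.dist_0_eq_abs, abs_of_nonneg (norm_nonneg _)]
  have e : (((t : ℝ)⁻¹ : ℝ) : ℂ) • (hP.limitSemigroup t y - y) - a =
      (((t : ℝ)⁻¹ : ℝ) : ℂ) • (hP.limitSemigroup t y - y - (t : ℝ) • a) := by
    rw [smul_sub _ _ ((t : ℝ) • a), Complex.coe_smul, Complex.coe_smul, inv_smul_smul₀ ht'.ne']
  rw [e, norm_smul, Complex.norm_real, norm_inv, Real.norm_of_nonneg ht'.le, inv_mul_lt_iff₀ ht']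
  have h2 := key t k
  rw [mul_comm] at h2
  refine h2.trans_lt (mul_lt_mul_of_pos_left ?_ ht')
  linarith

end IsContractionResolvent

end Generation

/-! ### Algebra of resolvents -/

section Resolvent

variable {X : Type*} [AddCommGroup X] [Lattice X] [IsOrderedAddMonoid X] [Module ℝ X]
  [IsOrderedModule ℝ X] {A : Complexification X →ₗ.[ℂ] Complexification X} {μ ν : ℂ}

theorem ruResolvent_shifted (h : μ ∈ ruResolventSet A) (x : A.domain) :
    ruResolvent A μ (shifted A μ x) = x := by
  have h' : Function.Bijective (shifted A μ) := h
  rw [ruResolvent, dif_pos h']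
  simp only [LinearMap.comp_apply, LinearEquiv.coe_coe, Submodule.subtype_apply]
  exact congrArg _ ((LinearEquiv.ofBijective (shifted A μ) h').symm_apply_apply x)

theorem ruResolvent_eq_of_mem_graph (h : μ ∈ ruResolventSet A) {x z : Complexification X}
    (hx : (x, μ • x - z) ∈ A.graph) : ruResolvent A μ z = x := by
  obtain ⟨y, hy, hAy⟩ := (A.mem_graph_iff).1 hx
  have hy' : (y : Complexification X) = x := hy
  have e : shifted A μ y = z := by
    change μ • (y : Complexification X) - A y = z
    rw [hAy, hy']
    simp
  rw [← e, ruResolvent_shifted h, hy']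

theorem ruResolvent_mem_graph (h : μ ∈ ruResolventSet A) (z : Complexification X) :
    (ruResolvent A μ z, μ • ruResolvent A μ z - z) ∈ A.graph := by
  obtain ⟨x, rfl⟩ := h.2 z
  refine (A.mem_graph_iff).2 ⟨x, (ruResolvent_shifted h x).symm, ?_⟩
  rw [ruResolvent_shifted h]
  change A x = μ • (x : Complexification X) - (μ • (x : Complexification X) - A x)
  abel

theorem ruResolvent_mem_graph_of_eq (h : μ ∈ ruResolventSet A) {x y : Complexification X}
    (e : ruResolvent A μ (μ • x - y) = x) : (x, y) ∈ A.graph := by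
  have := ruResolvent_mem_graph h (μ • x - y)
  rwa [e, sub_sub_cancel] at this

theorem ruResolvent_eq_self_of_mem_graph (h : μ ∈ ruResolventSet A) {x y : Complexification X}
    (hx : (x, y) ∈ A.graph) : ruResolvent A μ (μ • x - y) = x :=
  ruResolvent_eq_of_mem_graph h (by rwa [sub_sub_cancel])

/-- The resolvent identity. -/
theorem ruResolvent_sub_ruResolvent (hμ : μ ∈ ruResolventSet A) (hν : ν ∈ ruResolventSet A)
    (z : Complexification X) :
    ruResolvent A μ z - ruResolvent A ν z = (ν - μ) • ruResolvent A μ (ruResolvent A ν z) := by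
  have h := ruResolvent_eq_self_of_mem_graph hμ (ruResolvent_mem_graph hν z)
  have e : μ • ruResolvent A ν z - (ν • ruResolvent A ν z - z) =
      (μ - ν) • ruResolvent A ν z + z := by
    rw [sub_smul]
    abel
  rw [e, map_add, map_smul] at h
  rw [← neg_sub μ ν, neg_smul]
  refine sub_eq_zero.1 (Eq.trans ?_ (sub_eq_zero.2 h))
  abel

end Resolvent

/-! ### The rescaled semigroup on orbit spaces -/

section Semigroup

variable {X : Type*} [AddCommGroup X] [Lattice X] [IsOrderedAddMonoid X] [Module ℝ X]
  [IsOrderedModule ℝ X]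

/-- The orbit of `x` has the right derivative `y` at `0`, in the sense of ru-convergence. -/
def HasRuDeriv (T : ℝ≥0 → Module.End ℂ (Complexification X)) (x y : Complexification X) : Prop :=
  CRuTendsto (fun h : ℝ≥0 => (((h : ℝ)⁻¹ : ℝ) : ℂ) • (T h x - x)) (𝓝[>] 0) y

/-- The semigroup rescaled by `t ↦ exp (c t)`. -/
noncomputable def expScale (c : ℝ) (T : ℝ≥0 → Module.End ℂ (Complexification X)) (t : ℝ≥0) :
    Module.End ℂ (Complexification X) :=
  ((Real.exp (c * t) : ℝ) : ℂ) • T t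

theorem expScale_expScale_neg (c : ℝ) (T : ℝ≥0 → Module.End ℂ (Complexification X)) :
    expScale c (expScale (-c) T) = T := by
  funext t
  rw [expScale, expScale, smul_smul, ← Complex.ofReal_mul, ← Real.exp_add, neg_mul,
    add_neg_cancel, Real.exp_zero, Complex.ofReal_one, one_smul]

theorem tendsto_exp_smul_zero (c : ℝ) (l : Filter ℝ≥0) (hl : l ≤ 𝓝 0) :
    Tendsto (fun h : ℝ≥0 => ((Real.exp (c * h) : ℝ) : ℂ)) l (𝓝 1) := by
  have : Continuous fun h : ℝ≥0 => ((Real.exp (c * h) : ℝ) : ℂ) := by fun_prop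
  simpa using (this.tendsto 0).mono_left hl

theorem HasRuDeriv.expScale {T : ℝ≥0 → Module.End ℂ (Complexification X)}
    {x y : Complexification X} (h : HasRuDeriv T x y) (c : ℝ) :
    HasRuDeriv (expScale c T) x (y + (c : ℂ) • x) := by
  have h1 : Tendsto (fun h : ℝ≥0 => (((h : ℝ)⁻¹ * (Real.exp (c * h) - 1) : ℝ) : ℂ)) (𝓝[>] 0)
      (𝓝 (c : ℂ)) := by
    have hd : HasDerivAt (fun s : ℝ => Real.exp (c * s)) c 0 := by
      simpa using ((hasDerivAt_id (0 : ℝ)).const_mul c).exp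
    have h2 : Tendsto (fun h : ℝ≥0 => (h : ℝ)) (𝓝[>] 0) (𝓝[≠] 0) := by
      refine tendsto_nhdsWithin_iff.2 ⟨?_, ?_⟩
      · exact (NNReal.continuous_coe.tendsto 0).mono_left nhdsWithin_le_nhds
      · filter_upwards [self_mem_nhdsWithin] with t ht
        exact NNReal.coe_ne_zero.2 (ne_of_gt ht)
    have h3 := (hasDerivAt_iff_tendsto_slope_zero.1 hd).comp h2
    refine (Complex.continuous_ofReal.tendsto c).comp (h3.congr fun t => ?_)
    simp
  have h4 := (CRuTendsto.smul_of_tendsto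
    (tendsto_exp_smul_zero c (𝓝[>] 0) nhdsWithin_le_nhds) h).add
    (CRuTendsto.smul_of_tendsto h1 (CRuTendsto.const _ x))
  rw [one_smul] at h4
  refine h4.congr' (Eventually.of_forall fun t => ?_)
  simp only [RuSemigroup.expScale, LinearMap.smul_apply, Complex.ofReal_mul, Complex.ofReal_sub,
    Complex.ofReal_one]
  module

end Semigroup

section SemigroupFamily

variable {X : Type*} [AddCommGroup X] [Lattice X] [IsOrderedAddMonoid X] [Module ℝ X]
  [IsOrderedModule ℝ X] {T : ℝ≥0 → Module.End ℂ (Complexification X)} {w : ℝ}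

theorem expScale_zero (hT : IsPositiveRucSemigroup T) (c : ℝ) : expScale c T 0 = 1 := by
  simp [expScale, hT.map_zero]

theorem expScale_add (hT : IsPositiveRucSemigroup T) (c : ℝ) (s t : ℝ≥0) :
    expScale c T (s + t) = expScale c T t * expScale c T s := by
  rw [expScale, hT.map_add, expScale, expScale, smul_mul_smul_comm, NNReal.coe_add, mul_add,
    add_comm (c * s), Real.exp_add, Complex.ofReal_mul]

/-- The positive family of the operators `exp (-w t) T(t)`. -/
def IsPositiveRucSemigroup.family (hT : IsPositiveRucSemigroup T) (w : ℝ) : PositiveFamily X where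
  carrier := Set.range (expScale (-w) T)
  one_mem := ⟨0, expScale_zero hT _⟩
  positive := by
    rintro _ ⟨t, rfl⟩
    exact (hT.positive t).smul (Real.exp_pos _).le

namespace IsPositiveRucSemigroup

theorem exists_orbitLE (hT : IsPositiveRucSemigroup T)
    (hw : HasOrderExponent T w) (z : Complexification X) :
    ∃ v, (hT.family w).OrbitLE z v := by
  obtain ⟨v, hv⟩ := hw z
  refine ⟨v, ?_⟩
  rintro _ ⟨t, rfl⟩
  have h := (hv t).smul ((Real.exp (-w * t) : ℝ) : ℂ)
  rw [Complex.norm_real, Real.norm_of_nonneg (Real.exp_pos _).le, smul_smul, ← Real.exp_add,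
    neg_mul, neg_add_cancel, Real.exp_zero, one_smul, ← neg_mul] at h
  exact h

theorem orbitLE_expScale (hT : IsPositiveRucSemigroup T) (t : ℝ≥0) (z : Complexification X) (v : X)
    (h : (hT.family w).OrbitLE z v) : (hT.family w).OrbitLE (expScale (-w) T t z) v := by
  rintro _ ⟨s, rfl⟩
  rw [← Module.End.mul_apply, ← expScale_add hT]
  exact h _ ⟨_, rfl⟩

variable [Fact (IsArchimedean X)]

/-- The rescaled semigroup acts on each of its orbit spaces by contractions. -/
noncomputable def onOrbitSpace (hT : IsPositiveRucSemigroup T) (w : ℝ) (u : X) (t : ℝ≥0) :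
    orbitSpace (hT.family w) u →L[ℂ] orbitSpace (hT.family w) u :=
  orbitSpace.restrict (expScale (-w) T t) (hT.orbitLE_expScale t) u

theorem coe_onOrbitSpace (hT : IsPositiveRucSemigroup T)
    (u : X) (t : ℝ≥0) (z : orbitSpace (hT.family w) u) :
    (hT.onOrbitSpace w u t z : Complexification X) = expScale (-w) T t z := rfl

theorem isContractionSemigroup (hT : IsPositiveRucSemigroup T) (w : ℝ) (u : X) :
    IsContractionSemigroup (hT.onOrbitSpace w u) where
  map_zero := by
    ext1 z
    apply Subtype.ext
    rw [coe_onOrbitSpace, expScale_zero hT]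
    rfl
  map_add s t := by
    ext1 z
    apply Subtype.ext
    rw [coe_onOrbitSpace, expScale_add hT]
    rfl
  norm_le t := orbitSpace.norm_restrict_le _ _ _

/-- Every vector has a norm continuous orbit in a suitable orbit space. -/
theorem exists_isContinuousVector (hT : IsPositiveRucSemigroup T)
    (hw : HasOrderExponent T w) (z : Complexification X) :
    ∃ (u : X) (hz : z ∈ orbitSpace (hT.family w) u),
      IsContinuousVector (hT.onOrbitSpace w u) ⟨z, hz⟩ := by
  have hlim : CRuTendsto (fun h => expScale (-w) T h z) (𝓝 0) z := by
    obtain ⟨u, hu⟩ := hT.ruContinuous z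
    have h1 : CRuTendsto (fun h => T h z) (𝓝 0) z := by
      refine ⟨u 0, fun ε hε => ?_⟩
      obtain ⟨δ, hδ, h⟩ := hu ε hε
      filter_upwards [Metric.ball_mem_nhds (0 : ℝ≥0) hδ] with s hs
      have h2 := h 0 s (by rw [← NNReal.dist_eq]; exact (Metric.mem_ball.1 hs).le)
      simpa [hT.map_zero] using h2
    have h2 := CRuTendsto.smul_of_tendsto (tendsto_exp_smul_zero (-w) (𝓝 0) le_rfl) h1
    rw [one_smul] at h2
    exact h2
  obtain ⟨v, hv⟩ := hlim
  obtain ⟨v₁, hv₁⟩ := hT.exists_orbitLE hw (ofReal v)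
  obtain ⟨v₂, hv₂⟩ := hT.exists_orbitLE hw z
  have h₁ := hv₁.modulusLE.nonneg
  have h₂ := hv₂.modulusLE.nonneg
  refine ⟨v₁ + v₂, (hv₂.mono (le_add_of_nonneg_left h₁)).mem, ?_⟩
  exact orbitSpace.tendsto_of_eventually
    (hv₁.mono ((le_add_of_nonneg_right h₂).trans (le_abs_self _))) hv

theorem _root_.RuSemigroup.HasOrbitDeriv.hasRuDeriv (hT : IsPositiveRucSemigroup T)
    {u : X} {x y : orbitSpace (hT.family w) u}
    (h : HasOrbitDeriv (hT.onOrbitSpace w u) x y) :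
    HasRuDeriv T x ((y : Complexification X) + (w : ℂ) • (x : Complexification X)) := by
  have h1 : HasRuDeriv (expScale (-w) T) (x : Complexification X) y := orbitSpace.cRuTendsto h
  have h2 := h1.expScale w
  rwa [expScale_expScale_neg] at h2

/-- ru-derivatives of orbits are norm derivatives in a suitable orbit space. -/
theorem exists_hasOrbitDeriv (hT : IsPositiveRucSemigroup T)
    (hw : HasOrderExponent T w) {x y : Complexification X}
    (h : HasRuDeriv T x y) : ∃ (u : X) (hx : x ∈ orbitSpace (hT.family w) u)
      (hy : y - (w : ℂ) • x ∈ orbitSpace (hT.family w) u),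
      HasOrbitDeriv (hT.onOrbitSpace w u) ⟨x, hx⟩ ⟨y - (w : ℂ) • x, hy⟩ := by
  have h1 := h.expScale (-w)
  have e : y + ((-w : ℝ) : ℂ) • x = y - (w : ℂ) • x := by
    rw [Complex.ofReal_neg, neg_smul, sub_eq_add_neg]
  rw [e] at h1
  obtain ⟨v, hv⟩ := h1
  obtain ⟨v₁, hv₁⟩ := hT.exists_orbitLE hw (ofReal v)
  obtain ⟨v₂, hv₂⟩ := hT.exists_orbitLE hw x
  obtain ⟨v₃, hv₃⟩ := hT.exists_orbitLE hw (y - (w : ℂ) • x)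
  have h₁ := hv₁.modulusLE.nonneg
  have h₂ := hv₂.modulusLE.nonneg
  have h₃ := hv₃.modulusLE.nonneg
  refine ⟨v₁ + v₂ + v₃, (hv₂.mono ?_).mem, (hv₃.mono ?_).mem, ?_⟩
  · exact (le_add_of_nonneg_left h₁).trans (le_add_of_nonneg_right h₃)
  · exact le_add_of_nonneg_left (add_nonneg h₁ h₂)
  · refine orbitSpace.tendsto_of_eventually (v := v) (hv₁.mono ?_) hv
    exact ((le_add_of_nonneg_right h₂).trans (le_add_of_nonneg_right h₃)).trans (le_abs_self _)

variable [Fact (IsRuComplete X)]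

/-- Points to the right of the order exponent are not eigenvalues of the generator. -/
theorem eq_zero_of_hasRuDeriv (hT : IsPositiveRucSemigroup T)
    (hw : HasOrderExponent T w) {x : Complexification X} {μ : ℂ}
    (hμ : w < μ.re) (h : HasRuDeriv T x (μ • x)) : x = 0 := by
  obtain ⟨u, hx, hy, h1⟩ := hT.exists_hasOrbitDeriv hw h
  have hμ' : 0 < (μ - w).re := by simpa using hμ
  have h2 := (hT.isContractionSemigroup w u).laplace_smul_sub h1 hμ'
  have e : (μ - w) • (⟨x, hx⟩ : orbitSpace (hT.family w) u) - ⟨μ • x - (w : ℂ) • x, hy⟩ = 0 := by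
    apply Subtype.ext
    simp [sub_smul]
  rw [e] at h2
  have h3 := (hT.isContractionSemigroup w u).norm_laplace_le hμ' 0
  rw [h2, norm_zero, mul_zero, norm_le_zero_iff] at h3
  exact congrArg Subtype.val h3

variable {A : Complexification X →ₗ.[ℂ] Complexification X}

theorem laplace_mem_graph (hT : IsPositiveRucSemigroup T)
    (hA : IsGenerator A T) {μ : ℂ} (hμ : w < μ.re) {u : X}
    {z : orbitSpace (hT.family w) u} (hz : IsContinuousVector (hT.onOrbitSpace w u) z) :
    (((IsContractionSemigroup.laplace (hT.onOrbitSpace w u) (μ - w) z :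
        orbitSpace (hT.family w) u) : Complexification X),
      μ • ((IsContractionSemigroup.laplace (hT.onOrbitSpace w u) (μ - w) z :
        orbitSpace (hT.family w) u) : Complexification X) - z) ∈ A.graph := by
  have hμ' : 0 < (μ - w).re := by simpa using hμ
  have h1 := ((hT.isContractionSemigroup w u).hasOrbitDeriv_laplace hz hμ').hasRuDeriv hT
  refine (hA _ _).2 ?_
  refine Eq.mp (congrArg _ ?_) h1
  rw [Submodule.coe_sub, Submodule.coe_smul, sub_smul]
  abel

theorem mem_ruResolventSet (hT : IsPositiveRucSemigroup T)
    (hw : HasOrderExponent T w) (hA : IsGenerator A T) {μ : ℂ}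
    (hμ : w < μ.re) : μ ∈ ruResolventSet A := by
  constructor
  · refine (injective_iff_map_eq_zero _).2 fun x hx => ?_
    have hx' : A x = μ • (x : Complexification X) := (sub_eq_zero.1 hx).symm
    have h1 : ((x : Complexification X), μ • (x : Complexification X)) ∈ A.graph := by
      rw [← hx']
      exact A.mem_graph x
    exact Subtype.ext (hT.eq_zero_of_hasRuDeriv hw hμ ((hA _ _).1 h1))
  · intro z
    obtain ⟨u, hz, hc⟩ := hT.exists_isContinuousVector hw z
    obtain ⟨x, hx, hAx⟩ := (A.mem_graph_iff).1 (hT.laplace_mem_graph hA hμ hc)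
    refine ⟨x, ?_⟩
    change μ • (x : Complexification X) - A x = z
    rw [hAx, hx]
    simp

/-- The resolvent is given by the Laplace transform of the semigroup in orbit spaces. -/
theorem ruResolvent_eq_laplace (hT : IsPositiveRucSemigroup T)
    (hw : HasOrderExponent T w) (hA : IsGenerator A T) {μ : ℂ}
    (hμ : w < μ.re) {u : X} {z : orbitSpace (hT.family w) u}
    (hz : IsContinuousVector (hT.onOrbitSpace w u) z) :
    ruResolvent A μ z = IsContractionSemigroup.laplace (hT.onOrbitSpace w u) (μ - w) z :=
  ruResolvent_eq_of_mem_graph (hT.mem_ruResolventSet hw hA hμ) (hT.laplace_mem_graph hA hμ hz)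

/-- Powers of the resolvent stay in one orbit space, with the norm estimate of a contraction
semigroup. -/
theorem exists_ruResolvent_pow (hT : IsPositiveRucSemigroup T)
    (hw : HasOrderExponent T w) (hA : IsGenerator A T) {μ : ℂ}
    (hμ : w < μ.re) {u : X} {z : orbitSpace (hT.family w) u}
    (hz : IsContinuousVector (hT.onOrbitSpace w u) z) (k : ℕ) :
    ∃ y : orbitSpace (hT.family w) u, IsContinuousVector (hT.onOrbitSpace w u) y ∧
      (ruResolvent A μ ^ k) z = y ∧ ‖y‖ ≤ ((μ.re - w) ^ k)⁻¹ * ‖z‖ := by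
  have hS := hT.isContractionSemigroup w u
  have hμ' : 0 < (μ - w).re := by simpa using hμ
  induction k with
  | zero => exact ⟨z, hz, by simp, by simp⟩
  | succ k ih =>
    obtain ⟨y, hy, e, hn⟩ := ih
    refine ⟨IsContractionSemigroup.laplace (hT.onOrbitSpace w u) (μ - w) y,
      (hS.hasOrbitDeriv_laplace hy hμ').isContinuousVector hS.map_zero, ?_, ?_⟩
    · rw [pow_succ', Module.End.mul_apply, e, hT.ruResolvent_eq_laplace hw hA hμ hy]
    · have h1 := hS.norm_laplace_le hμ' y
      rw [Complex.sub_re, Complex.ofReal_re] at h1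
      have hpos : 0 < μ.re - w := sub_pos.2 hμ
      refine h1.trans ((mul_le_mul_of_nonneg_left hn (inv_nonneg.2 hpos.le)).trans_eq ?_)
      rw [pow_succ', mul_inv, mul_assoc]

theorem exists_ruResolvent_pow_bound (hT : IsPositiveRucSemigroup T)
    (hw : HasOrderExponent T w) (hA : IsGenerator A T)
    (z : Complexification X) : ∃ u : X, ∀ (k : ℕ) (μ : ℂ), w < μ.re →
      ModulusLE ((ruResolvent A μ ^ k) z) (((μ.re - w) ^ k)⁻¹ • u) := by
  obtain ⟨u, hz, hc⟩ := hT.exists_isContinuousVector hw z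
  refine ⟨‖(⟨z, hz⟩ : orbitSpace (hT.family w) u)‖ • |u|, fun k μ hμ => ?_⟩
  obtain ⟨y, -, e, hn⟩ := hT.exists_ruResolvent_pow hw hA hμ hc k
  rw [show (ruResolvent A μ ^ k) z = y from e, smul_smul]
  exact (orbitSpace.modulusLE_norm y).mono (smul_le_smul_of_nonneg_right hn (abs_nonneg u))

theorem isPositiveOp_ruResolvent (hT : IsPositiveRucSemigroup T)
    (hw : HasOrderExponent T w) (hA : IsGenerator A T) {r : ℝ}
    (hr : w < r) : IsPositiveOp (ruResolvent A r) := by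
  intro x hx
  obtain ⟨u, hz, hc⟩ := hT.exists_isContinuousVector hw (ofReal x)
  have h1 := hT.ruResolvent_eq_laplace hw hA (μ := r) (by simpa using hr) hc
  have h2 := (hT.isContractionSemigroup w u).laplace_mem hc (sub_pos.2 hr)
    (K := orbitSpace.positiveCone (hT.family w) u) orbitSpace.isClosed_positiveCone
    (fun _ hy _ hz => orbitSpace.add_mem_positiveCone hy hz)
    (fun _ ha _ hy => orbitSpace.smul_mem_positiveCone ha hy) fun t => by
      obtain ⟨y, hy, e⟩ := (hT.family w).positive _ ⟨t, rfl⟩ x hx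
      exact ⟨y, hy, e⟩
  obtain ⟨y, hy, e⟩ := h2
  refine ⟨y, hy, ?_⟩
  rw [show ruResolvent A r (ofReal x) = _ from h1, ← e, Complex.ofReal_sub]

theorem isRuDenselyDefined (hT : IsPositiveRucSemigroup T)
    (hw : HasOrderExponent T w) (hA : IsGenerator A T) :
    IsRuDenselyDefined A := by
  intro z
  obtain ⟨u, hz, hc⟩ := hT.exists_isContinuousVector hw z
  have hS := hT.isContractionSemigroup w u
  have hlim := orbitSpace.cRuTendsto (hS.tendsto_average hc)
  refine ⟨fun n => ⟨_, ?_⟩, hlim⟩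
  refine A.domain.smul_mem _ ?_
  have h1 := (hA _ _).2 ((hS.hasOrbitDeriv_integral hc (1 / ((n : ℝ≥0) + 1))).hasRuDeriv hT)
  exact LinearPMap.mem_domain_of_mem_graph h1

end IsPositiveRucSemigroup

/-- An operator with a positive resolvent at some point is ru-closed. -/
theorem isRuClosedOp_of_isPositiveOp (hX : IsArchimedean X)
    {A : Complexification X →ₗ.[ℂ] Complexification X} {μ : ℂ} (hμ : μ ∈ ruResolventSet A)
    (hpos : IsPositiveOp (ruResolvent A μ)) : IsRuClosedOp A := by
  intro s x y hx hy
  have h1 := ((hx.smul μ).sub hy).map hpos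
  have h2 : ∀ n, ruResolvent A μ (μ • (s n : Complexification X) - A (s n)) = s n := fun n =>
    ruResolvent_shifted hμ (s n)
  simp only [h2] at h1
  have h3 := ruResolvent_mem_graph_of_eq hμ (h1.unique hX hx)
  obtain ⟨d, hd, hAd⟩ := (A.mem_graph_iff).1 h3
  obtain rfl : (d : Complexification X) = x := hd
  exact ⟨d.2, hAd⟩

end SemigroupFamily

/-! ### Orbits of the normalized resolvents -/

section Generator

variable {X : Type*} [AddCommGroup X] [Lattice X] [IsOrderedAddMonoid X] [Module ℝ X]
  [IsOrderedModule ℝ X] {A : Complexification X →ₗ.[ℂ] Complexification X} {w : ℝ}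

/-- The Hille–Yosida conditions on the resolvent at real points, for positive operators. -/
structure IsPositiveHilleYosida (A : Complexification X →ₗ.[ℂ] Complexification X) (w : ℝ) :
    Prop where
  dense : IsRuDenselyDefined A
  pos : ∀ r : ℝ, w < r → (r : ℂ) ∈ positiveResolventSet A
  bound : ∀ z : Complexification X, ∃ u : X, ∀ (k : ℕ) (r : ℝ), w < r →
    ModulusLE ((ruResolvent A r ^ k) z) (((r - w) ^ k)⁻¹ • u)

/-- The normalized resolvent `r R(w + r, A)`. -/
noncomputable def normResolvent (A : Complexification X →ₗ.[ℂ] Complexification X) (w r : ℝ) :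
    Module.End ℂ (Complexification X) :=
  (r : ℂ) • ruResolvent A ((w + r : ℝ) : ℂ)

theorem normResolvent_zero (A : Complexification X →ₗ.[ℂ] Complexification X) (w : ℝ) :
    normResolvent A w 0 = 0 := by simp [normResolvent]

/-- If `y j` is a convex combination, with fixed weights, of `y (j + 1)` and of elements bounded
by `U`, and if the sequence `y` is order bounded, then `y` is bounded by `U`. -/
theorem modulusLE_of_recursion (hX : IsArchimedean X) {x y : ℕ → Complexification X} {U v : X}
    {a : ℝ} (ha : 0 < a) (ha' : a ≤ 1)
    (h : ∀ j, y j = (a : ℂ) • x j + ((1 - a : ℝ) : ℂ) • y (j + 1))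
    (hx : ∀ j, ModulusLE (x j) U) (hy : ∀ j, ModulusLE (y j) v) (j : ℕ) : ModulusLE (y j) U := by
  have key : ∀ n j, ModulusLE (y j) (U + (1 - a) ^ n • v) := by
    intro n
    induction n with
    | zero =>
      intro j
      rw [pow_zero, one_smul]
      exact (hy j).mono (le_add_of_nonneg_left (hx 0).nonneg)
    | succ n ih =>
      intro j
      rw [h j]
      have h1 := ((hx j).smul (a : ℂ)).add ((ih (j + 1)).smul ((1 - a : ℝ) : ℂ))
      rw [Complex.norm_real, Complex.norm_real, Real.norm_of_nonneg ha.le,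
        Real.norm_of_nonneg (sub_nonneg.2 ha')] at h1
      refine h1.mono (le_of_eq ?_)
      rw [pow_succ']
      module
  refine ModulusLE.of_forall_add_smul hX (u := v) fun ε hε => ?_
  obtain ⟨n, hn⟩ := exists_pow_lt_of_lt_one hε (show 1 - a < 1 by linarith)
  exact (key n j).mono
    (add_le_add_right (smul_le_smul_of_nonneg_right hn.le (hy 0).nonneg) U)

namespace IsPositiveHilleYosida

theorem mem_ruResolventSet (hA : IsPositiveHilleYosida A w) {r : ℝ} (hr : 0 < r) :
    ((w + r : ℝ) : ℂ) ∈ ruResolventSet A := (hA.pos (w + r) (by linarith)).1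

theorem isPositiveOp (hA : IsPositiveHilleYosida A w) {r : ℝ} (hr : 0 < r) :
    IsPositiveOp (normResolvent A w r) :=
  (hA.pos (w + r) (by linarith)).2.smul hr.le

theorem resolvent_identity (hA : IsPositiveHilleYosida A w) {r s : ℝ} (hr : 0 < r) (hs : 0 < s)
    (z : Complexification X) : (s : ℂ) • normResolvent A w r z - (r : ℂ) • normResolvent A w s z =
      ((s : ℂ) - r) • normResolvent A w r (normResolvent A w s z) := by
  have h := ruResolvent_sub_ruResolvent (hA.mem_ruResolventSet hr) (hA.mem_ruResolventSet hs) z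
  simp only [normResolvent, LinearMap.smul_apply, map_smul]
  have h' := congrArg (fun y => ((r : ℂ) * s) • y) h
  simp only [smul_sub, smul_smul] at h' ⊢
  rw [mul_comm (s : ℂ) r, h']
  congr 1
  push_cast
  ring

theorem commute (hA : IsPositiveHilleYosida A w) {r s : ℝ} (hr : 0 < r) (hs : 0 < s) :
    Commute (normResolvent A w r) (normResolvent A w s) := by
  rcases eq_or_ne r s with rfl | hrs
  · exact Commute.refl _
  refine LinearMap.ext fun z => ?_
  have h := hA.resolvent_identity hr hs z
  rw [← neg_sub, hA.resolvent_identity hs hr z, ← neg_smul, neg_sub] at h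
  exact (smul_right_injective _ (sub_ne_zero.2 (Complex.ofReal_injective.ne hrs.symm)) h).symm

theorem apply_eq_convex (hA : IsPositiveHilleYosida A w) {r s : ℝ} (hr : 0 < r) (hs : 0 < s)
    (z : Complexification X) : normResolvent A w r z = ((r / s : ℝ) : ℂ) • normResolvent A w s z +
      ((1 - r / s : ℝ) : ℂ) • normResolvent A w s (normResolvent A w r z) := by
  have h := hA.resolvent_identity hs hr z
  have hs' : (s : ℂ) ≠ 0 := Complex.ofReal_ne_zero.2 hs.ne'
  refine smul_right_injective _ hs' ?_
  simp only [smul_add, smul_smul]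
  have e1 : (s : ℂ) * ((r / s : ℝ) : ℂ) = r := by
    push_cast
    field_simp
  have e2 : (s : ℂ) * ((1 - r / s : ℝ) : ℂ) = -((r : ℂ) - s) := by
    push_cast
    field_simp
    ring
  rw [e1, e2, neg_smul, ← h]
  abel

/-- The positive family of all powers of the normalized resolvents. -/
def family (hA : IsPositiveHilleYosida A w) : PositiveFamily X where
  carrier := {S | ∃ (r : ℝ) (k : ℕ), 0 < r ∧ S = normResolvent A w r ^ k}
  one_mem := ⟨1, 0, one_pos, (pow_zero _).symm⟩
  positive := by
    rintro _ ⟨r, k, hr, rfl⟩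
    exact (hA.isPositiveOp hr).pow k

theorem exists_orbitLE (hA : IsPositiveHilleYosida A w) (z : Complexification X) :
    ∃ v, hA.family.OrbitLE z v := by
  obtain ⟨u, hu⟩ := hA.bound z
  refine ⟨u, ?_⟩
  rintro _ ⟨r, k, hr, rfl⟩
  have h := (hu k (w + r) (by linarith)).smul ((r : ℂ) ^ k)
  rw [add_sub_cancel_left, norm_pow, Complex.norm_real, Real.norm_of_nonneg hr.le,
    smul_inv_smul₀ (pow_ne_zero k hr.ne')] at h
  rw [normResolvent, smul_pow]
  exact h

/-- The normalized resolvents do not enlarge the orbits under all their powers. By the resolvent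
identity, one of `normResolvent A w r` and `normResolvent A w s` is an infinite convex combination
of powers of the other, which gives the estimate for mixed products. -/
theorem orbitLE_normResolvent (hX : IsArchimedean X) (hA : IsPositiveHilleYosida A w) {r : ℝ}
    (hr : 0 ≤ r) (z : Complexification X) (v : X) (h : hA.family.OrbitLE z v) :
    hA.family.OrbitLE (normResolvent A w r z) v := by
  rcases hr.eq_or_lt with rfl | hr
  · intro S _
    rw [normResolvent_zero, LinearMap.zero_apply, map_zero]
    exact ModulusLE.zero h.modulusLE.nonneg
  rintro _ ⟨s, k, hs, rfl⟩
  rcases le_or_gt r s with hrs | hrs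
  · obtain ⟨v', hv'⟩ := hA.exists_orbitLE (normResolvent A w r z)
    refine modulusLE_of_recursion hX (y := fun j =>
      (normResolvent A w s ^ (k + j)) (normResolvent A w r z))
      (x := fun j => (normResolvent A w s ^ (k + j + 1)) z)
      (div_pos hr hs) ((div_le_one hs).2 hrs) (fun j => ?_)
      (fun j => h _ ⟨s, _, hs, rfl⟩) (fun j => hv' _ ⟨s, _, hs, rfl⟩) 0
    have e : k + (j + 1) = k + j + 1 := rfl
    conv_lhs => rw [hA.apply_eq_convex hr hs z]
    rw [map_add, map_smul, map_smul, e, pow_succ]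
    rfl
  · have key : ∀ k j : ℕ,
        ModulusLE ((normResolvent A w s ^ k) ((normResolvent A w r ^ j) z)) v := by
      intro k
      induction k with
      | zero => exact fun j => h _ ⟨r, j, hr, rfl⟩
      | succ k ih =>
        have hpos := (hA.isPositiveOp hs).pow (k + 1)
        obtain ⟨v', hv'⟩ := exists_modulusLE ((normResolvent A w s ^ (k + 1)) (ofReal v))
        refine modulusLE_of_recursion hX
          (x := fun j => (normResolvent A w s ^ k) ((normResolvent A w r ^ (j + 1)) z))
          (div_pos hs hr) ((div_le_one hr).2 hrs.le) (fun j => ?_) (fun j => ih (j + 1))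
          (fun j => hpos.modulusLE (h _ ⟨r, j, hr, rfl⟩) hv')
        have e := hA.apply_eq_convex hs hr ((normResolvent A w r ^ j) z)
        rw [← Module.End.mul_apply (normResolvent A w r) (normResolvent A w s),
          (hA.commute hr hs).eq] at e
        rw [pow_succ, Module.End.mul_apply, e, map_add, map_smul, map_smul, pow_succ' _ j]
        rfl
    simpa using key k 1

/-! ### Strong convergence of the normalized resolvents -/

theorem normResolvent_sub_of_mem_graph (hA : IsPositiveHilleYosida A w) {r : ℝ} (hr : 0 < r)
    {x y : Complexification X} (hx : (x, y) ∈ A.graph) :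
    normResolvent A w r x - x = (r : ℂ)⁻¹ • normResolvent A w r (y - (w : ℂ) • x) := by
  have h := ruResolvent_eq_self_of_mem_graph (hA.mem_ruResolventSet hr) hx
  have hr' : (r : ℂ) ≠ 0 := Complex.ofReal_ne_zero.2 hr.ne'
  rw [normResolvent, LinearMap.smul_apply, LinearMap.smul_apply, inv_smul_smul₀ hr', ← sub_eq_zero]
  have h' := sub_eq_zero.2 h
  have e : ((w + r : ℝ) : ℂ) • x = (w : ℂ) • x + (r : ℂ) • x := by
    rw [Complex.ofReal_add, add_smul]
  rw [e, map_sub, map_add, map_smul, map_smul] at h'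
  rw [map_sub, map_smul, ← h']
  abel

/-- On the domain the normalized resolvents ru-converge to the identity. -/
theorem cRuTendsto_of_mem_graph (hA : IsPositiveHilleYosida A w) {x y : Complexification X}
    (hx : (x, y) ∈ A.graph) : CRuTendsto (fun n : ℕ => normResolvent A w n x) atTop x := by
  obtain ⟨v, hv⟩ := hA.exists_orbitLE (y - (w : ℂ) • x)
  refine ⟨v, fun ε hε => ?_⟩
  have h1 := tendsto_inv_atTop_zero.comp (tendsto_natCast_atTop_atTop (R := ℝ))
  filter_upwards [h1.eventually (gt_mem_nhds hε), eventually_gt_atTop 0] with n hn hn0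
  have hn' : (0 : ℝ) < n := by exact_mod_cast hn0
  rw [hA.normResolvent_sub_of_mem_graph hn' hx]
  have h2 := (hv _ ⟨n, 1, hn', (pow_one _).symm⟩).smul ((n : ℝ) : ℂ)⁻¹
  rw [norm_inv, Complex.norm_real, Real.norm_of_nonneg hn'.le] at h2
  exact h2.mono (smul_le_smul_of_nonneg_right hn.le hv.modulusLE.nonneg)

/-- The domain is invariant under complex conjugation, since it is the range of a positive
operator. -/
theorem exists_re_mem_graph (hA : IsPositiveHilleYosida A w) (x : A.domain) :
    ∃ y, (ofReal (x : Complexification X).re, y) ∈ A.graph := by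
  have h := hA.pos (w + 1) (by linarith)
  refine ⟨((w + 1 : ℝ) : ℂ) • ofReal (x : Complexification X).re -
      ofReal (shifted A ((w + 1 : ℝ) : ℂ) x).re, ?_⟩
  refine ruResolvent_mem_graph_of_eq h.1 ?_
  rw [sub_sub_cancel, h.2.apply_ofReal, ← h.2.re_apply, ruResolvent_shifted h.1]

/-- Property `(D)`, applied to the operators `normResolvent A w n - 1` restricted to `X`, extends
the convergence of the normalized resolvents from the domain to the whole space. -/
theorem cRuTendsto_normResolvent (hD : PropertyD X) (hA : IsPositiveHilleYosida A w)
    (z : Complexification X) :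
    CRuTendsto (fun n : ℕ => normResolvent A w n z) atTop z := by
  have hpos : ∀ n : ℕ, IsPositiveOp (normResolvent A w n) := fun n => by
    rcases n.eq_zero_or_pos with rfl | hn
    · intro x _
      exact ⟨0, le_rfl, by rw [Nat.cast_zero, normResolvent_zero]; rfl⟩
    · exact hA.isPositiveOp (by exact_mod_cast hn)
  have hreal : ∀ x : X, RuTendsto (fun n : ℕ => (normResolvent A w n (ofReal x)).re) atTop x := by
    -- The index set is lifted to the universe of `X`, as property `(D)` requires.
    let B : ULift ℕ → X →ₗ[ℝ] X := fun a =>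
      { toFun := fun x => (normResolvent A w a.down (ofReal x)).re - x
        map_add' := fun x y => by
          rw [ofReal_add, map_add, add_re]
          abel
        map_smul' := fun c x => by
          rw [ofReal_smul, map_smul, Complex.coe_smul, real_smul_re, RingHom.id_apply, smul_sub] }
    have hB := hD (ULift ℕ) B ⟨{x | ∃ y, (ofReal x, y) ∈ A.graph}, ?_, ?_⟩ ?_
    · intro x
      obtain ⟨u, hu⟩ := hB x
      refine ⟨u, fun ε hε => ?_⟩
      obtain ⟨a, ha⟩ := eventually_atTop.1 (hu ε hε)
      filter_upwards [eventually_ge_atTop a.down] with n hn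
      have h1 := ha ⟨n⟩ hn
      rw [sub_zero] at h1
      exact h1
    · intro x
      obtain ⟨s, hs⟩ := hA.dense (ofReal x)
      exact ⟨fun n => (s n : Complexification X).re, fun n => hA.exists_re_mem_graph (s n), hs.re⟩
    · rintro x ⟨y, hxy⟩
      obtain ⟨u, hu⟩ := (hA.cRuTendsto_of_mem_graph hxy).re
      refine ⟨u, fun ε hε => ?_⟩
      obtain ⟨N, hN⟩ := eventually_atTop.1 (hu ε hε)
      filter_upwards [eventually_ge_atTop (⟨N⟩ : ULift ℕ)] with a ha
      rw [sub_zero]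
      exact hN a.down ha
    · rintro x ⟨v, hv⟩
      obtain ⟨v', hv'⟩ := hA.exists_orbitLE (ofReal v)
      refine ⟨v' + |v|, add_nonneg hv'.modulusLE.nonneg (abs_nonneg v), fun ε hε => ?_⟩
      obtain ⟨N, hN⟩ := eventually_atTop.1 (hv ε hε)
      refine ⟨N, ⟨1⟩, fun n hn a ha => ?_⟩
      have ha' : (0 : ℝ) < a.down := by exact_mod_cast (show 1 ≤ a.down from ha)
      have h1 : ModulusLE (ofReal (x n)) (ε • v) :=
        modulusLE_ofReal.2 (by simpa using hN n hn)
      have h2 := ((hA.isPositiveOp ha').modulusLE_smul hε.le h1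
        (hv' _ ⟨_, 1, ha', (pow_one _).symm⟩)).sub
        (h1.mono (smul_le_smul_of_nonneg_left (le_abs_self v) hε.le))
      rw [← smul_add] at h2
      exact h2.abs_re
  refine CRuTendsto.of_re_im (x := z.re) (y := z.im) ?_ ?_
  · simpa only [← (hpos _).re_apply] using hreal z.re
  · simpa only [← (hpos _).im_apply] using hreal z.im

end IsPositiveHilleYosida

end Generator

/-! ### The generated semigroup -/

section Generated

variable {X : Type*} [AddCommGroup X] [Lattice X] [IsOrderedAddMonoid X] [Module ℝ X]
  [IsOrderedModule ℝ X] {A : Complexification X →ₗ.[ℂ] Complexification X} {w : ℝ}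
  [hX : Fact (IsArchimedean X)]

namespace IsPositiveHilleYosida

/-- The normalized resolvent at the natural number `n` as a contraction of an orbit space. -/
noncomputable def onOrbitSpace (hA : IsPositiveHilleYosida A w) (u : X) (n : ℕ) :
    orbitSpace hA.family u →L[ℂ] orbitSpace hA.family u :=
  orbitSpace.restrict (normResolvent A w n)
    (hA.orbitLE_normResolvent hX.out n.cast_nonneg) u

theorem coe_onOrbitSpace (hA : IsPositiveHilleYosida A w) (u : X) (n : ℕ)
    (z : orbitSpace hA.family u) :
    (hA.onOrbitSpace u n z : Complexification X) = normResolvent A w n z := rfl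

theorem isContractionResolvent (hA : IsPositiveHilleYosida A w) (u : X) :
    IsContractionResolvent (hA.onOrbitSpace u) where
  zero := by
    ext1 z
    apply Subtype.ext
    rw [coe_onOrbitSpace, Nat.cast_zero, normResolvent_zero]
    rfl
  norm_le n := orbitSpace.norm_restrict_le _ _ _
  resolvent m n := by
    ext1 z
    apply Subtype.ext
    change (m : ℂ) • normResolvent A w n z - (n : ℂ) • normResolvent A w m z =
      ((m : ℂ) - n) • normResolvent A w n (normResolvent A w m z)
    rcases n.eq_zero_or_pos with rfl | hn
    · simp [normResolvent_zero]
    rcases m.eq_zero_or_pos with rfl | hm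
    · simp [normResolvent_zero]
    exact hA.resolvent_identity (by exact_mod_cast hn) (by exact_mod_cast hm) z

/-- `z` belongs to the orbit space of `u` and the normalized resolvents applied to `z` converge to
`z` in its norm. -/
def IsContinuousAt (hA : IsPositiveHilleYosida A w) (u : X) (z : Complexification X) : Prop :=
  ∃ hz : z ∈ orbitSpace hA.family u, ⟨z, hz⟩ ∈ continuousVectors (hA.onOrbitSpace u)

theorem exists_isContinuousAt (hD : PropertyD X) (hA : IsPositiveHilleYosida A w)
    (z : Complexification X) : ∃ u, hA.IsContinuousAt u z := by
  obtain ⟨v, hv⟩ := hA.cRuTendsto_normResolvent hD z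
  obtain ⟨v₁, hv₁⟩ := hA.exists_orbitLE (ofReal v)
  obtain ⟨v₂, hv₂⟩ := hA.exists_orbitLE z
  have h₁ := hv₁.modulusLE.nonneg
  have h₂ := hv₂.modulusLE.nonneg
  refine ⟨v₁ + v₂, (hv₂.mono (le_add_of_nonneg_left h₁)).mem, ?_⟩
  exact orbitSpace.tendsto_of_eventually
    (hv₁.mono ((le_add_of_nonneg_right h₂).trans (le_abs_self _))) hv

theorem IsContinuousAt.mono {hA : IsPositiveHilleYosida A w} {u v : X} {z : Complexification X}
    (h : hA.IsContinuousAt u z) (huv : |u| ≤ |v|) : hA.IsContinuousAt v z := by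
  obtain ⟨hz, hc⟩ := h
  exact ⟨orbitSpace_mono huv hz, ((orbitSpace.inclusion huv).continuous.tendsto _).comp hc⟩

theorem IsContinuousAt.add {hA : IsPositiveHilleYosida A w} {u : X} {z z' : Complexification X}
    (h : hA.IsContinuousAt u z) (h' : hA.IsContinuousAt u z') : hA.IsContinuousAt u (z + z') := by
  refine ⟨Submodule.add_mem _ h.1 h'.1, ?_⟩
  have e : (⟨z + z', Submodule.add_mem _ h.1 h'.1⟩ : orbitSpace hA.family u) =
    ⟨z, h.1⟩ + ⟨z', h'.1⟩ := Subtype.ext rfl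
  rw [e]
  exact Submodule.add_mem (continuousVectors (hA.onOrbitSpace u)) h.2 h'.2

theorem IsContinuousAt.smul {hA : IsPositiveHilleYosida A w} {u : X} {z : Complexification X}
    (h : hA.IsContinuousAt u z) (c : ℂ) : hA.IsContinuousAt u (c • z) := by
  refine ⟨Submodule.smul_mem _ c h.1, ?_⟩
  have e : (⟨c • z, Submodule.smul_mem _ c h.1⟩ : orbitSpace hA.family u) = c • ⟨z, h.1⟩ :=
    Subtype.ext rfl
  rw [e]
  exact Submodule.smul_mem (continuousVectors (hA.onOrbitSpace u)) c h.2

variable [Fact (IsRuComplete X)]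

/-- The contraction semigroup generated on the continuous vectors of an orbit space. -/
noncomputable def orbitSemigroup (hA : IsPositiveHilleYosida A w) (u : X) (t : ℝ≥0) :
    continuousVectors (hA.onOrbitSpace u) →L[ℂ] continuousVectors (hA.onOrbitSpace u) :=
  (hA.isContractionResolvent u).limitSemigroup t

/-- The value of the semigroup of the orbit space of `u` at a continuous vector. -/
noncomputable def value (hA : IsPositiveHilleYosida A w) {u : X} (t : ℝ≥0) {z : Complexification X}
    (h : hA.IsContinuousAt u z) : Complexification X :=
  ((hA.orbitSemigroup u t ⟨⟨z, h.1⟩, h.2⟩ : orbitSpace hA.family u) : Complexification X)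

theorem isContinuousAt_value (hA : IsPositiveHilleYosida A w) {u : X} (t : ℝ≥0)
    {z : Complexification X} (h : hA.IsContinuousAt u z) :
    hA.IsContinuousAt u (hA.value t h) :=
  ⟨_, (hA.orbitSemigroup u t ⟨⟨z, h.1⟩, h.2⟩).2⟩

theorem value_eq_of_le (hA : IsPositiveHilleYosida A w) {u v : X} (t : ℝ≥0)
    {z : Complexification X} (h : hA.IsContinuousAt u z) (huv : |u| ≤ |v|)
    (h' : hA.IsContinuousAt v z) : hA.value t h = hA.value t h' := by
  have h1 := ((orbitSpace.inclusion huv).continuous.tendsto _).comp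
    ((hA.isContractionResolvent u).tendsto_limitSemigroup t ⟨⟨z, h.1⟩, h.2⟩)
  have h2 := (hA.isContractionResolvent v).tendsto_limitSemigroup t ⟨⟨z, h'.1⟩, h'.2⟩
  exact congrArg Subtype.val (tendsto_nhds_unique h1 (h2.congr fun n =>
    (yosidaExp_intertwine (orbitSpace.inclusion huv) (fun _ => rfl) t ⟨z, h.1⟩).symm))

/-- The value of the semigroup does not depend on the orbit space. -/
theorem value_eq (hA : IsPositiveHilleYosida A w) {u v : X} (t : ℝ≥0) {z : Complexification X}
    (h : hA.IsContinuousAt u z) (h' : hA.IsContinuousAt v z) : hA.value t h = hA.value t h' := by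
  have hu : |u| ≤ |(|u| + |v|)| :=
    (le_add_of_nonneg_right (abs_nonneg v)).trans (le_abs_self _)
  have hv : |v| ≤ |(|u| + |v|)| :=
    (le_add_of_nonneg_left (abs_nonneg u)).trans (le_abs_self _)
  rw [hA.value_eq_of_le t h hu (h.mono hu), hA.value_eq_of_le t h' hv (h.mono hu)]

theorem value_add (hA : IsPositiveHilleYosida A w) {u : X} (t : ℝ≥0) {z z' : Complexification X}
    (h : hA.IsContinuousAt u z) (h' : hA.IsContinuousAt u z') :
    hA.value t (h.add h') = hA.value t h + hA.value t h' := by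
  have e := map_add (hA.orbitSemigroup u t) ⟨⟨z, h.1⟩, h.2⟩ ⟨⟨z', h'.1⟩, h'.2⟩
  exact congrArg (fun y : continuousVectors (hA.onOrbitSpace u)
    => ((y : orbitSpace hA.family u) : Complexification X)) e

theorem value_smul (hA : IsPositiveHilleYosida A w) {u : X} (t : ℝ≥0) {z : Complexification X}
    (h : hA.IsContinuousAt u z) (c : ℂ) : hA.value t (h.smul c) = c • hA.value t h := by
  have e := map_smul (hA.orbitSemigroup u t) c ⟨⟨z, h.1⟩, h.2⟩
  exact congrArg (fun y : continuousVectors (hA.onOrbitSpace u)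
    => ((y : orbitSpace hA.family u) : Complexification X)) e

theorem value_zero (hA : IsPositiveHilleYosida A w) {u : X} {z : Complexification X}
    (h : hA.IsContinuousAt u z) : hA.value 0 h = z := by
  have e := (hA.isContractionResolvent u).isContractionSemigroup.map_zero
  rw [value, orbitSemigroup, e]
  rfl

theorem value_value (hA : IsPositiveHilleYosida A w) {u : X} (s t : ℝ≥0) {z : Complexification X}
    (h : hA.IsContinuousAt u z) :
    hA.value t (hA.isContinuousAt_value s h) = hA.value (s + t) h := by
  have e := (hA.isContractionResolvent u).isContractionSemigroup.map_add s t
  simp only [value, orbitSemigroup]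
  rw [e]
  rfl

theorem exists_value_ofReal (hA : IsPositiveHilleYosida A w) {u : X} (t : ℝ≥0) {x : X}
    (hx : 0 ≤ x) (h : hA.IsContinuousAt u (ofReal x)) :
    ∃ y, 0 ≤ y ∧ hA.value t h = ofReal y := by
  have h1 := (hA.isContractionResolvent u).tendsto_limitSemigroup t ⟨⟨ofReal x, h.1⟩, h.2⟩
  refine orbitSpace.isClosed_positiveCone.mem_of_tendsto h1 (Eventually.of_forall fun n => ?_)
  refine yosidaExp_mem orbitSpace.isClosed_positiveCone ⟨0, le_rfl, rfl⟩
    (fun _ hy _ hz => orbitSpace.add_mem_positiveCone hy hz)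
    (fun _ ha _ hy => orbitSpace.smul_mem_positiveCone ha hy) ?_ t.coe_nonneg ⟨x, hx, rfl⟩
  rintro z ⟨y, hy, e⟩
  rcases n.eq_zero_or_pos with rfl | hn
  · rw [(hA.isContractionResolvent u).zero]
    exact ⟨0, le_rfl, rfl⟩
  · obtain ⟨y', hy', e'⟩ := hA.isPositiveOp (r := n) (by exact_mod_cast hn) y hy
    exact ⟨y', hy', by rw [coe_onOrbitSpace, e, e']⟩

/-- The semigroup generated by `A`, glued from the semigroups on the orbit spaces. -/
noncomputable def semigroup (hA : IsPositiveHilleYosida A w) (hD : PropertyD X) (t : ℝ≥0) :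
    Module.End ℂ (Complexification X) where
  toFun z := ((Real.exp (w * t) : ℝ) : ℂ) • hA.value t (hA.exists_isContinuousAt hD z).choose_spec
  map_add' z z' := by
    obtain ⟨u, hu⟩ := hA.exists_isContinuousAt hD z
    obtain ⟨v, hv⟩ := hA.exists_isContinuousAt hD z'
    have hu' := hu.mono (v := |u| + |v|)
      ((le_add_of_nonneg_right (abs_nonneg v)).trans (le_abs_self _))
    have hv' := hv.mono (v := |u| + |v|)
      ((le_add_of_nonneg_left (abs_nonneg u)).trans (le_abs_self _))
    rw [hA.value_eq t _ hu', hA.value_eq t _ hv', hA.value_eq t _ (hu'.add hv'), hA.value_add,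
      smul_add]
  map_smul' c z := by
    obtain ⟨u, hu⟩ := hA.exists_isContinuousAt hD z
    rw [hA.value_eq t _ hu, hA.value_eq t _ (hu.smul c), hA.value_smul, RingHom.id_apply, smul_comm]

theorem semigroup_apply (hA : IsPositiveHilleYosida A w) (hD : PropertyD X) (t : ℝ≥0) {u : X}
    {z : Complexification X} (h : hA.IsContinuousAt u z) :
    hA.semigroup hD t z = ((Real.exp (w * t) : ℝ) : ℂ) • hA.value t h := by
  change ((Real.exp (w * t) : ℝ) : ℂ) • hA.value t _ = _
  rw [hA.value_eq t _ h]

theorem modulusLE_value (hA : IsPositiveHilleYosida A w) {u : X} (t : ℝ≥0) {z : Complexification X}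
    (h : hA.IsContinuousAt u z) :
    ModulusLE (hA.value t h) (‖(⟨z, h.1⟩ : orbitSpace hA.family u)‖ • |u|) :=
  (orbitSpace.modulusLE_norm _).mono (smul_le_smul_of_nonneg_right
    ((hA.isContractionResolvent u).isContractionSemigroup.norm_apply_le t ⟨⟨z, h.1⟩, h.2⟩)
    (abs_nonneg u))

theorem hasOrderExponent_semigroup (hA : IsPositiveHilleYosida A w) (hD : PropertyD X) :
    HasOrderExponent (hA.semigroup hD) w := by
  intro z
  obtain ⟨u, hu⟩ := hA.exists_isContinuousAt hD z
  refine ⟨‖(⟨z, hu.1⟩ : orbitSpace hA.family u)‖ • |u|, fun t => ?_⟩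
  rw [hA.semigroup_apply hD t hu]
  have h := (hA.modulusLE_value t hu).smul ((Real.exp (w * t) : ℝ) : ℂ)
  rwa [Complex.norm_real, Real.norm_of_nonneg (Real.exp_pos _).le] at h

theorem isRuContinuous_semigroup (hA : IsPositiveHilleYosida A w) (hD : PropertyD X)
    (z : Complexification X) : IsRuContinuous fun t => hA.semigroup hD t z := by
  obtain ⟨u, hu⟩ := hA.exists_isContinuousAt hD z
  refine ⟨fun t => Real.exp (w * t) • |u|, fun ε hε => ?_⟩
  set x : continuousVectors (hA.onOrbitSpace u) := ⟨⟨z, hu.1⟩, hu.2⟩ with hx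
  have hS := (hA.isContractionResolvent u).isContractionSemigroup
  have hc := (hA.isContractionResolvent u).isContinuousVector x
  set S := (hA.isContractionResolvent u).limitSemigroup with hSdef
  have lim : Tendsto (fun r : ℝ => Real.exp (w * r) * ‖S |r|.toNNReal x - x‖ +
      |Real.exp (w * r) - 1| * ‖x‖) (𝓝 0) (𝓝 0) := by
    have h2 : Continuous fun r : ℝ => S |r|.toNNReal x :=
      (hS.continuous_orbit_real hc).comp continuous_abs
    have h3 : Continuous fun r : ℝ => Real.exp (w * r) := by fun_prop
    have h1 := (h3.mul (h2.sub (continuous_const (y := x))).norm).add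
      ((h3.sub (continuous_const (y := 1))).abs.mul (continuous_const (y := ‖x‖)))
    exact h1.tendsto' 0 0 (by simp [hS.map_zero])
  obtain ⟨δ, hδ, h⟩ := Metric.eventually_nhds_iff.1 (lim.eventually (gt_mem_nhds hε))
  refine ⟨δ / 2, half_pos hδ, fun t s hts => ?_⟩
  have h1 : Real.exp (w * (s - t)) * ‖S |(s : ℝ) - t|.toNNReal x - x‖ +
      |Real.exp (w * (s - t)) - 1| * ‖x‖ < ε := by
    refine h ?_
    rw [Real.dist_0_eq_abs]
    linarith
  have hd : |(s : ℝ) - t|.toNNReal = nndist s t := by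
    rw [← NNReal.dist_eq, ← coe_nndist, Real.toNNReal_coe]
  rw [hd] at h1
  have h2 : ‖((Real.exp (w * (s - t)) : ℝ) : ℂ) • S s x - S t x‖ ≤ ε := by
    have e : ((Real.exp (w * (s - t)) : ℝ) : ℂ) • S s x - S t x =
        ((Real.exp (w * (s - t)) : ℝ) : ℂ) • (S s x - S t x) +
          ((Real.exp (w * (s - t)) - 1 : ℝ) : ℂ) • S t x := by
      rw [Complex.ofReal_sub, Complex.ofReal_one]
      module
    rw [e]
    refine (norm_add_le _ _).trans (le_trans (add_le_add ?_ ?_) h1.le)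
    · rw [norm_smul, Complex.norm_real, Real.norm_of_nonneg (Real.exp_pos _).le]
      exact mul_le_mul_of_nonneg_left (hS.norm_apply_sub_apply_le s t x) (Real.exp_pos _).le
    · rw [norm_smul, Complex.norm_real, Real.norm_eq_abs]
      exact mul_le_mul_of_nonneg_left (hS.norm_apply_le t x) (abs_nonneg _)
  have h3 := ((orbitSpace.modulusLE_norm _).mono
    (smul_le_smul_of_nonneg_right h2 (abs_nonneg u))).smul ((Real.exp (w * t) : ℝ) : ℂ)
  rw [Complex.norm_real, Real.norm_of_nonneg (Real.exp_pos _).le, smul_comm] at h3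
  beta_reduce
  rw [hA.semigroup_apply hD s hu, hA.semigroup_apply hD t hu]
  convert h3 using 1
  change _ = ((Real.exp (w * t) : ℝ) : ℂ) • (((Real.exp (w * (s - t)) : ℝ) : ℂ) • hA.value s hu -
    hA.value t hu)
  rw [smul_sub, smul_smul, ← Complex.ofReal_mul, ← Real.exp_add]
  congr 5
  ring

theorem isPositiveRucSemigroup (hA : IsPositiveHilleYosida A w) (hD : PropertyD X) :
    IsPositiveRucSemigroup (hA.semigroup hD) where
  map_zero := by
    ext1 z
    obtain ⟨u, hu⟩ := hA.exists_isContinuousAt hD z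
    rw [hA.semigroup_apply hD 0 hu, hA.value_zero]
    simp
  map_add s t := by
    ext1 z
    obtain ⟨u, hu⟩ := hA.exists_isContinuousAt hD z
    rw [Module.End.mul_apply, hA.semigroup_apply hD s hu, map_smul,
      hA.semigroup_apply hD t (hA.isContinuousAt_value s hu), hA.value_value,
      hA.semigroup_apply hD _ hu, smul_smul, ← Complex.ofReal_mul, ← Real.exp_add, NNReal.coe_add,
      mul_add]
  ruContinuous := hA.isRuContinuous_semigroup hD
  positive t x hx := by
    obtain ⟨u, hu⟩ := hA.exists_isContinuousAt hD (ofReal x)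
    obtain ⟨y, hy, e⟩ := hA.exists_value_ofReal t hx hu
    refine ⟨Real.exp (w * t) • y, smul_nonneg (Real.exp_pos _).le hy, ?_⟩
    rw [hA.semigroup_apply hD t hu, e, ofReal_smul]

/-- The generator of the constructed semigroup extends `A`. -/
theorem hasRuDeriv_semigroup (hA : IsPositiveHilleYosida A w) (hD : PropertyD X)
    {x y : Complexification X} (hxy : (x, y) ∈ A.graph) : HasRuDeriv (hA.semigroup hD) x y := by
  set z := ((w + 1 : ℝ) : ℂ) • x - y with hz
  have hx : ruResolvent A ((w + 1 : ℝ) : ℂ) z = x :=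
    ruResolvent_eq_self_of_mem_graph (hA.mem_ruResolventSet one_pos) hxy
  have hPz : normResolvent A w (1 : ℕ) z = x := by
    rw [normResolvent, Nat.cast_one, Complex.ofReal_one, one_smul]
    exact hx
  obtain ⟨u, hu⟩ := hA.exists_isContinuousAt hD z
  have hR := hA.isContractionResolvent u
  have h1 := hR.hasOrbitDeriv 1 ⟨⟨z, hu.1⟩, hu.2⟩
  have hxu : hA.IsContinuousAt u x := by
    have := hR.apply_mem_continuousVectors 1 hu.2
    rw [← hPz]
    exact ⟨_, this⟩
  have h2 := orbitSpace.cRuTendsto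
    (((continuousVectors (hA.onOrbitSpace u)).subtypeL.continuous.tendsto _).comp h1)
  have h3 : HasRuDeriv (expScale (-w) (hA.semigroup hD)) x (x - z) := by
    have e : ((yosida (hA.onOrbitSpace u) 1 ⟨z, hu.1⟩ : orbitSpace hA.family u) :
        Complexification X) = x - z := by
      change ((1 : ℕ) : ℂ) • (normResolvent A w (1 : ℕ) z - z) = x - z
      rw [hPz, Nat.cast_one, one_smul]
    rw [← e]
    refine CRuTendsto.congr' h2 (Eventually.of_forall fun t => ?_)
    have e2 : expScale (-w) (hA.semigroup hD) t x = hA.value t hxu := by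
      rw [expScale, LinearMap.smul_apply, hA.semigroup_apply hD t hxu, smul_smul,
        ← Complex.ofReal_mul, ← Real.exp_add, neg_mul, neg_add_cancel, Real.exp_zero,
        Complex.ofReal_one, one_smul]
    beta_reduce
    rw [e2]
    simp only [← hPz]
    rfl
  have h4 := h3.expScale w
  rw [expScale_expScale_neg] at h4
  refine Eq.mp (congrArg _ ?_) h4
  rw [hz, Complex.ofReal_add, Complex.ofReal_one]
  module

theorem isGenerator_semigroup (hA : IsPositiveHilleYosida A w) (hD : PropertyD X) :
    IsGenerator A (hA.semigroup hD) := by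
  refine fun x y => ⟨hA.hasRuDeriv_semigroup hD, fun h => ?_⟩
  -- `w + 1` lies in the resolvent set of `A` and is not an eigenvalue of the generator, which
  -- extends `A`; hence the two operators coincide.
  have hr := hA.mem_ruResolventSet one_pos
  set r : ℂ := ((w + 1 : ℝ) : ℂ) with hrdef
  have h1 := hA.hasRuDeriv_semigroup hD (ruResolvent_mem_graph hr (r • x - y))
  have h2 : HasRuDeriv (hA.semigroup hD) (ruResolvent A r (r • x - y) - x)
      (r • (ruResolvent A r (r • x - y) - x)) := by
    have h3 := CRuTendsto.sub h1 h
    have e : r • ruResolvent A r (r • x - y) - (r • x - y) - y =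
        r • (ruResolvent A r (r • x - y) - x) := by
      rw [smul_sub]
      abel
    rw [e] at h3
    refine h3.congr' (Eventually.of_forall fun t => ?_)
    beta_reduce
    rw [← smul_sub, map_sub (hA.semigroup hD t)]
    congr 1
    abel
  have h4 := (hA.isPositiveRucSemigroup hD).eq_zero_of_hasRuDeriv
    (hA.hasOrderExponent_semigroup hD) (by simp [hrdef]) h2
  exact ruResolvent_mem_graph_of_eq hr (sub_eq_zero.1 h4)

end IsPositiveHilleYosida

end Generated

end RuSemigroup

theorem mainTheorem2 {X : Type*} [AddCommGroup X] [Lattice X] [IsOrderedAddMonoid X]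
    [Module ℝ X] [IsOrderedModule ℝ X]
    (hArch : RuSemigroup.IsArchimedean X) (hcompl : RuSemigroup.IsRuComplete X)
    (hD : RuSemigroup.PropertyD X) (w : ℝ)
    (A : RuSemigroup.Complexification X →ₗ.[ℂ] RuSemigroup.Complexification X) :
    (∃ T : ℝ≥0 → Module.End ℂ (RuSemigroup.Complexification X),
        RuSemigroup.IsPositiveRucSemigroup T ∧ RuSemigroup.HasOrderExponent T w ∧
          RuSemigroup.IsGenerator A T) ↔
      (RuSemigroup.IsRuClosedOp A ∧ RuSemigroup.IsRuDenselyDefined A ∧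
        (∀ μ : ℂ, w < μ.re → μ ∈ RuSemigroup.ruResolventSet A) ∧
        (∀ r : ℝ, w < r → (r : ℂ) ∈ RuSemigroup.positiveResolventSet A) ∧
        ∀ z : RuSemigroup.Complexification X, ∃ u : X, ∀ (k : ℕ) (μ : ℂ), w < μ.re →
          RuSemigroup.Complexification.ModulusLE ((RuSemigroup.ruResolvent A μ ^ k) z)
            (((μ.re - w) ^ k)⁻¹ • u)) := by
  have : Fact (RuSemigroup.IsArchimedean X) := ⟨hArch⟩
  have : Fact (RuSemigroup.IsRuComplete X) := ⟨hcompl⟩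
  constructor
  · rintro ⟨T, hT, hw, hA⟩
    have hres : ∀ μ : ℂ, w < μ.re → μ ∈ RuSemigroup.ruResolventSet A := fun μ hμ =>
      hT.mem_ruResolventSet hw hA hμ
    have hpos : ∀ r : ℝ, w < r → (r : ℂ) ∈ RuSemigroup.positiveResolventSet A := fun r hr =>
      ⟨hres r (by simpa using hr), hT.isPositiveOp_ruResolvent hw hA hr⟩
    have h1 := hpos (w + 1) (by linarith)
    exact ⟨RuSemigroup.isRuClosedOp_of_isPositiveOp hArch h1.1 h1.2, hT.isRuDenselyDefined hw hA,
      hres, hpos, hT.exists_ruResolvent_pow_bound hw hA⟩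
  · rintro ⟨-, hdense, -, hpos, hbound⟩
    have hA : RuSemigroup.IsPositiveHilleYosida A w :=
      ⟨hdense, hpos, fun z => (hbound z).imp fun u hu k r hr => by
        simpa using hu k r (by simpa using hr)⟩
    exact ⟨hA.semigroup hD, hA.isPositiveRucSemigroup hD, hA.hasOrderExponent_semigroup hD,
      hA.isGenerator_semigroup hD⟩
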